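/- Let $\alpha \ge 1$ and $p \in [0,1)$. Let $m$ be Lebesgue measure on $\mathbb{C}$, let $m_{\mathbb{T}}$ be the uniform probability measure on the unit circle $\{|z|=1\}$, and let $$\overline{\mu}_p^\alpha = \frac1\alpha\left[\left(\mathbb{1}_{\{|z|\le \sqrt p\}} + \mathbb{1}_{\{1\le |z|\le \sqrt\alpha\}}\right)\frac{m}{\pi} + (1-p)\, m_{\mathbb{T}}\right].$$ For a compactly supported probability measure $\nu$ on $\mathbb{C}$ put $$I_\alpha(\nu) = \int_{\mathbb{C}} \frac{|z|^2}{\alpha}\,\mathrm{d}\nu(z) - \iint \log|z-w|\,\mathrm{d}\nu(z)\,\mathrm{d}\nu(w) \in (-\infty,+\infty],$$ where $\log 0 = -\infty$. Let $\varphi : \mathbb{C}\to\mathbb{R}$ be a $C^2$ function with compact support, let $\mathfrak{D}(\varphi) = \int_{\mathbb{C}} (\varphi_x^2+\varphi_y^2)\,\mathrm{d}m$, and let $\lambda > 0$. Then for every compactly supported probability measure $\nu$ on $\mathbb{C}$ such that $$\nu(\{|z|<1\}) \le \frac{p}{\alpha} \quad\text{and}\quad \left|\int_{\mathbb{C}}\varphi\,\mathrm{d}\nu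 - \int_{\mathbb{C}}\varphi\,\mathrm{d}\overline{\mu}_p^\alpha\right| \ge \lambda,$$ we have $$I_\alpha(\nu) \ge I_\alpha(\overline{\mu}_p^\alpha) + \frac{2\pi}{\mathfrak{D}(\varphi)}\,\lambda^2 .$$ -/

import Mathlib

open MeasureTheory

noncomputable section

namespace CoulombGas

/-- The integral of an extended-real-valued function: the integral of the positive part minus the
integral of the negative part. It is the usual value in `[-∞, ∞]` as soon as one of the two parts
has a finite integral. -/
def extIntegral {X : Type*} [MeasurableSpace X] (μ : Measure X) (f : X → EReal) : EReal :=
  ((∫⁻ x, (f x).toENNReal ∂μ : ENNReal) : EReal) - ((∫⁻ x, (-f x).toENNReal ∂μ : ENNReal) : EReal)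

/-- The logarithmic energy `Σ(μ) = ∬ log |z - w| dμ(z) dμ(w)`, where `log 0 = -∞`. For a compactly
supported finite `μ` the kernel is bounded above `μ × μ`-almost everywhere, so the value is in
`[-∞, ∞)`. -/
def logEnergy (μ : Measure ℂ) : EReal :=
  extIntegral (μ.prod μ) (fun q : ℂ × ℂ => ENNReal.log ‖q.1 - q.2‖ₑ)

/-- The functional `I_α(ν) = ∫ |z|² / α dν(z) - Σ(ν)`. -/
def energyFunctional (α : ℝ) (ν : Measure ℂ) : EReal :=
  ((∫⁻ z, ENNReal.ofReal (‖z‖ ^ 2 / α) ∂ν : ENNReal) : EReal) - logEnergy ν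

/-- The uniform probability measure `m_𝕋` on the unit circle, the law of `exp (i θ)` for `θ`
uniform on `(0, 2π]`. -/
def uniformCircle : Measure ℂ :=
  ENNReal.ofReal (1 / (2 * Real.pi)) •
    Measure.map (circleMap 0 1) (volume.restrict (Set.Ioc 0 (2 * Real.pi)))

/-- The measure `μ_p^α = (1_{|z| ≤ √p} + 1_{1 ≤ |z| ≤ √α}) m / π + (1 - p) m_𝕋`. -/
def limitMeasure (α p : ℝ) : Measure ℂ :=
  ENNReal.ofReal (1 / Real.pi) •
      (volume.restrict {z : ℂ | ‖z‖ ≤ √p} + volume.restrict {z : ℂ | 1 ≤ ‖z‖ ∧ ‖z‖ ≤ √α})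
    + ENNReal.ofReal (1 - p) • uniformCircle

/-- The normalized measure `μ̄_p^α = μ_p^α / α`. -/
def normLimitMeasure (α p : ℝ) : Measure ℂ :=
  ENNReal.ofReal (1 / α) • limitMeasure α p

/-- The set `𝓕_p(α)` of probability measures giving mass at most `p / α` to the open unit disk. -/
def deficientMeasures (α p : ℝ) : Set (ProbabilityMeasure ℂ) :=
  {μ | (μ : Measure ℂ) (Metric.ball 0 1) ≤ ENNReal.ofReal (p / α)}

/-- The set `𝓛_{φ,λ}` of probability measures `μ` with `|∫ φ dμ - ∫ φ dμ̄_p^α| ≥ λ`. -/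
def farMeasures (α p : ℝ) (φ : ℂ → ℝ) (lam : ℝ) : Set (ProbabilityMeasure ℂ) :=
  {μ | |(∫ w, φ w ∂(μ : Measure ℂ)) - ∫ w, φ w ∂(normLimitMeasure α p)| ≥ lam}

/-- The Dirichlet energy `𝔇(φ) = ∫ (φ_x² + φ_y²) dm`. -/
def dirichletEnergy (φ : ℂ → ℝ) : ℝ :=
  ∫ z : ℂ, ((fderiv ℝ φ z 1) ^ 2 + (fderiv ℝ φ z Complex.I) ^ 2)

end CoulombGas

end

noncomputable section

namespace CoulombGas

open Filter Topology Set

/-! Write μ for the limit measure, U for its logarithmic potential, Σ(·,·) for the mutual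
logarithmic energy and V(z) = |z|² - 2αU(z). Expanding both energies gives I(ν) - I(μ) = (∫V dν - ∫V
dμ)/α + [2Σ(ν,μ) - Σ(ν,ν) - Σ(μ,μ)], and the two terms are bounded separately.

The linear term is nonnegative (`integral_effectivePotential_le`). Newton's theorem gives U
explicitly, whence V ≥ c - g·1_{|z|<1} with equality μ-almost everywhere, where c = α - α log α and
g = 1 - p + p log p ≥ 0. The constraint on ν then says exactly that ν charges the open disk no more
than μ does.

The bracket is -Σ(ν-μ), and it dominates 2π(∫φ d(ν-μ))²/𝔇(φ) (`energy_sub_ge`). The logarithmic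
kernel is negative semidefinite on neutral charges (`sum_integral_log_nonpos`), because Frullani's
formula writes -log as a mixture of Gaussians minus constants and Gaussian kernels are positive
definite. This is applied to the neutral charge ν - μ + tΔφ dm: Green's formula evaluates every term
containing Δφ, and optimizing over t gives the bound. A measure ν of infinite energy is trivial. -/

/-- The Laplacian of a function on the plane, as the sum of two iterated partial derivatives. -/
def lap (φ : ℂ → ℝ) (z : ℂ) : ℝ :=
  fderiv ℝ (fun y => fderiv ℝ φ y 1) z 1 + fderiv ℝ (fun y => fderiv ℝ φ y Complex.I) z Complex.I

/-! ### Green's representation through a regularized logarithm. -/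

lemma locallyIntegrable_log_norm : LocallyIntegrable (fun w : ℂ => Real.log ‖w‖) volume := by
  rw [locallyIntegrable_iff]
  intro K hK
  obtain ⟨r, hr⟩ := hK.isBounded.subset_ball (0 : ℂ)
  refine IntegrableOn.mono_set ?_ hr
  -- In polar coordinates the Jacobian turns the logarithm into y log y, which is continuous at 0.
  rw [integrableOn_fun_norm_addHaar volume (f := Real.log)]
  have : IntegrableOn (fun y => y * Real.log y) (Icc 0 r) :=
    Real.continuous_mul_log.continuousOn.integrableOn_Icc
  simpa using this.mono_set Ioo_subset_Icc_self

lemma locallyIntegrable_log_norm_sub (z : ℂ) :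
    LocallyIntegrable (fun w : ℂ => Real.log ‖z - w‖) volume := by
  rw [locallyIntegrable_iff]
  intro K hK
  have h := locallyIntegrable_log_norm.integrableOn_isCompact
    (hK.image (f := fun w => z - w) (by fun_prop))
  have e : MeasurableEmbedding (fun w : ℂ => z - w) :=
    (Homeomorph.subLeft z).measurableEmbedding
  have mp : MeasurePreserving (fun w : ℂ => z - w) volume volume :=
    Measure.measurePreserving_sub_left volume z
  have := (mp.integrableOn_comp_preimage e (f := fun w => Real.log ‖w‖)).2 h
  refine this.mono_set (subset_preimage_image _ _)

lemma hasCompactSupport_fderiv_apply {φ : ℂ → ℝ} (hc : HasCompactSupport φ) (v : ℂ) :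
    HasCompactSupport (fun y => fderiv ℝ φ y v) :=
  hc.fderiv_apply (𝕜 := ℝ) v

lemma contDiff_fderiv_apply {φ : ℂ → ℝ} {n m : ℕ∞} (h : ContDiff ℝ n φ) (hmn : m + 1 ≤ n) (v : ℂ) :
    ContDiff ℝ m (fun y => fderiv ℝ φ y v) :=
  (h.fderiv_right (m := m) (by exact_mod_cast hmn)).clm_apply contDiff_const

/-- Integration by parts against a compactly supported `C¹` function. -/
lemma integral_mul_fderiv_of_hasLineDerivAt {φ : ℂ → ℝ} (hφ : ContDiff ℝ 1 φ)
    (hc : HasCompactSupport φ) {F F' : ℂ → ℝ} (hF : Continuous F) (hF' : Continuous F') (v : ℂ)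
    (h : ∀ w, HasLineDerivAt ℝ F (F' w) w v) :
    ∫ w, F w * fderiv ℝ φ w v = - ∫ w, F' w * φ w := by
  have hd : Continuous (fun w => fderiv ℝ φ w v) :=
    (hφ.continuous_fderiv (by norm_num)).clm_apply continuous_const
  exact integral_bilinear_hasLineDerivAt_right_eq_neg_left_of_integrable
    (B := ContinuousLinearMap.mul ℝ ℝ) (μ := volume) (v := v) (f := F) (f' := F') (g := φ)
    (g' := fun w => fderiv ℝ φ w v)
    ((hF'.mul hφ.continuous).integrable_of_hasCompactSupport hc.mul_left)
    ((hF.mul hd).integrable_of_hasCompactSupport (hasCompactSupport_fderiv_apply hc v).mul_left)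
    ((hF.mul hφ.continuous).integrable_of_hasCompactSupport hc.mul_left)
    (fun w _ => h w)
    (fun w _ => ((hφ.differentiable (by norm_num)) w).hasFDerivAt.hasLineDerivAt v)

lemma hasLineDerivAt_log_reg {d : ℝ} (hd : 0 < d) (w v : ℂ) :
    HasLineDerivAt ℝ (fun w : ℂ => Real.log (‖w‖ ^ 2 + d ^ 2) / 2)
      (inner ℝ w v / (‖w‖ ^ 2 + d ^ 2)) w v := by
  have h1 : HasDerivAt (fun t : ℝ => w + t • v) v 0 := by
    simpa using ((hasDerivAt_id (0 : ℝ)).smul_const v).const_add w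
  have h2 := ((h1.norm_sq.add_const (d ^ 2)).log (by positivity)).div_const 2
  refine h2.congr_deriv ?_
  simp
  field_simp

lemma hasLineDerivAt_inner_div_reg {d : ℝ} (hd : 0 < d) (w v : ℂ) :
    HasLineDerivAt ℝ (fun w : ℂ => inner ℝ w v / (‖w‖ ^ 2 + d ^ 2))
      (‖v‖ ^ 2 / (‖w‖ ^ 2 + d ^ 2) - 2 * (inner ℝ w v) ^ 2 / (‖w‖ ^ 2 + d ^ 2) ^ 2) w v := by
  have h1 : HasDerivAt (fun t : ℝ => w + t • v) v 0 := by
    simpa using ((hasDerivAt_id (0 : ℝ)).smul_const v).const_add w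
  have h2 := (h1.inner ℝ (hasDerivAt_const (0 : ℝ) v)).div (h1.norm_sq.add_const (d ^ 2))
    (by positivity)
  refine h2.congr_deriv ?_
  have : ‖w‖ ^ 2 + d ^ 2 ≠ 0 := by positivity
  simp
  field_simp

lemma continuous_log_reg {d : ℝ} (hd : 0 < d) :
    Continuous (fun w : ℂ => Real.log (‖w‖ ^ 2 + d ^ 2) / 2) := by
  refine (Continuous.log (by fun_prop) fun w => ?_).div_const 2
  positivity

/-- Two integrations by parts in each of the directions 1 and i. With A = |w|² + d², the second
derivatives of (log A)/2 add up to 2/A - 2|w|²/A² = 2d²/A², an approximate identity of mass 2π as d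
→ 0. -/
lemma integral_log_reg_mul_lap {φ : ℂ → ℝ} (hφ : ContDiff ℝ 2 φ) (hc : HasCompactSupport φ)
    {d : ℝ} (hd : 0 < d) :
    ∫ w, Real.log (‖w‖ ^ 2 + d ^ 2) / 2 * lap φ w
      = ∫ w, 2 * d ^ 2 / (‖w‖ ^ 2 + d ^ 2) ^ 2 * φ w := by
  have hpos : ∀ w : ℂ, ‖w‖ ^ 2 + d ^ 2 ≠ 0 := fun w => by positivity
  have c0 := continuous_log_reg hd
  have c1 : ∀ v : ℂ, Continuous (fun w : ℂ => inner ℝ w v / (‖w‖ ^ 2 + d ^ 2)) := fun v =>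
    (by fun_prop : Continuous fun w : ℂ => inner ℝ w v).div (by fun_prop) hpos
  have c2 : ∀ v : ℂ, Continuous (fun w : ℂ => ‖v‖ ^ 2 / (‖w‖ ^ 2 + d ^ 2)
      - 2 * (inner ℝ w v) ^ 2 / (‖w‖ ^ 2 + d ^ 2) ^ 2) := fun v =>
    (continuous_const.div (by fun_prop) hpos).sub
      ((by fun_prop : Continuous fun w : ℂ => 2 * (inner ℝ w v) ^ 2).div (by fun_prop)
        fun w => pow_ne_zero 2 (hpos w))
  have hd1 : ∀ v : ℂ, ContDiff ℝ 1 (fun y => fderiv ℝ φ y v) := fun v =>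
    contDiff_fderiv_apply (n := 2) (m := 1) hφ (by norm_num) v
  have key : ∀ v : ℂ, ∫ w, Real.log (‖w‖ ^ 2 + d ^ 2) / 2 *
      fderiv ℝ (fun y => fderiv ℝ φ y v) w v = ∫ w, (‖v‖ ^ 2 / (‖w‖ ^ 2 + d ^ 2)
      - 2 * (inner ℝ w v) ^ 2 / (‖w‖ ^ 2 + d ^ 2) ^ 2) * φ w := fun v => by
    rw [integral_mul_fderiv_of_hasLineDerivAt (hd1 v) (hasCompactSupport_fderiv_apply hc v) c0
      (c1 v) v (fun w => hasLineDerivAt_log_reg hd w v),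
      integral_mul_fderiv_of_hasLineDerivAt (hφ.of_le (by norm_num)) hc (c1 v) (c2 v) v
      (fun w => hasLineDerivAt_inner_div_reg hd w v), neg_neg]
  have i1 : ∀ v : ℂ, Integrable (fun w => Real.log (‖w‖ ^ 2 + d ^ 2) / 2 *
      fderiv ℝ (fun y => fderiv ℝ φ y v) w v) := fun v =>
    (c0.mul (((hd1 v).continuous_fderiv (by norm_num)).clm_apply
      continuous_const)).integrable_of_hasCompactSupport
      (hasCompactSupport_fderiv_apply (hasCompactSupport_fderiv_apply hc v) v).mul_left
  have i2 : ∀ v : ℂ, Integrable (fun w => (‖v‖ ^ 2 / (‖w‖ ^ 2 + d ^ 2)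
      - 2 * (inner ℝ w v) ^ 2 / (‖w‖ ^ 2 + d ^ 2) ^ 2) * φ w) := fun v =>
    ((c2 v).mul hφ.continuous).integrable_of_hasCompactSupport hc.mul_left
  simp only [lap, mul_add]
  rw [integral_add (i1 1) (i1 Complex.I), key, key, ← integral_add (i2 1) (i2 Complex.I)]
  refine integral_congr_ae (.of_forall fun w => ?_)
  have h1 := hpos w
  have h2 : ‖w‖ ^ 2 = w.re ^ 2 + w.im ^ 2 := by
    rw [← Complex.normSq_eq_norm_sq, Complex.normSq_apply]; ring
  simp only [Complex.inner, norm_one, Complex.norm_I]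
  simp only [Complex.conj_re, Complex.mul_re, Complex.I_re, Complex.I_im,
    Complex.conj_im, Complex.one_re, Complex.one_im]
  field_simp
  rw [h2]; ring

lemma integral_two_div_one_add_norm_sq_sq :
    Integrable (fun w : ℂ => 2 / (‖w‖ ^ 2 + 1) ^ 2) ∧
    ∫ w : ℂ, 2 / (‖w‖ ^ 2 + 1) ^ 2 = 2 * Real.pi := by
  have hder : ∀ x ∈ Ici (0 : ℝ), HasDerivAt (fun y : ℝ => - (y ^ 2 + 1)⁻¹)
      (x * (2 / (x ^ 2 + 1) ^ 2)) x := fun x _ => by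
    have h : HasDerivAt (fun y : ℝ => y ^ 2 + 1) (2 * x) x := by
      simpa using (hasDerivAt_pow 2 x).add_const 1
    refine (h.inv (by positivity)).neg.congr_deriv ?_
    field_simp
  have hpos : ∀ x ∈ Ioi (0 : ℝ), 0 ≤ x * (2 / (x ^ 2 + 1) ^ 2) := fun x hx => by
    have : 0 < x := hx
    positivity
  have hlim : Tendsto (fun y : ℝ => - (y ^ 2 + 1)⁻¹) atTop (𝓝 0) := by
    rw [← neg_zero]
    exact (tendsto_inv_atTop_zero.comp
      (tendsto_atTop_add_const_right _ _ (tendsto_pow_atTop two_ne_zero))).neg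
  constructor
  · rw [integrable_fun_norm_addHaar volume (f := fun y : ℝ => 2 / (y ^ 2 + 1) ^ 2)]
    simpa using integrableOn_Ioi_deriv_of_nonneg' hder hpos hlim
  · rw [integral_fun_norm_addHaar volume (f := fun y : ℝ => 2 / (y ^ 2 + 1) ^ 2)]
    have := integral_Ioi_of_hasDerivAt_of_nonneg' hder hpos hlim
    simp [this, Measure.real]

lemma lap_continuous {φ : ℂ → ℝ} (hφ : ContDiff ℝ 2 φ) : Continuous (lap φ) := by
  have hd1 : ∀ v : ℂ, ContDiff ℝ 1 (fun y => fderiv ℝ φ y v) := fun v =>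
    contDiff_fderiv_apply (n := 2) (m := 1) hφ (by norm_num) v
  exact (((hd1 1).continuous_fderiv (by norm_num)).clm_apply continuous_const).add
    (((hd1 _).continuous_fderiv (by norm_num)).clm_apply continuous_const)

lemma lap_hasCompactSupport {φ : ℂ → ℝ} (hc : HasCompactSupport φ) : HasCompactSupport (lap φ) :=
  (hasCompactSupport_fderiv_apply (hasCompactSupport_fderiv_apply hc 1) 1).add
    (hasCompactSupport_fderiv_apply (hasCompactSupport_fderiv_apply hc _) _)

/-- Rescaling by d moves the parameter from the kernel into the test function, so that dominated
convergence applies with a fixed kernel. -/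
lemma integral_reg_kernel_mul {φ : ℂ → ℝ} {d : ℝ} (hd : 0 < d) :
    ∫ w, 2 * d ^ 2 / (‖w‖ ^ 2 + d ^ 2) ^ 2 * φ w
      = ∫ w : ℂ, 2 / (‖w‖ ^ 2 + 1) ^ 2 * φ (d • w) := by
  have h := Measure.integral_comp_smul (volume : Measure ℂ)
    (fun w => 2 * d ^ 2 / (‖w‖ ^ 2 + d ^ 2) ^ 2 * φ w) d
  rw [Complex.finrank_real_complex, abs_of_pos (by positivity), smul_eq_mul, eq_comm,
    inv_mul_eq_iff_eq_mul₀ (by positivity)] at h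
  rw [h, ← integral_const_mul]
  refine integral_congr_ae (.of_forall fun w => ?_)
  simp only [norm_smul, Real.norm_eq_abs, abs_of_pos hd]
  have : (‖w‖ ^ 2 + 1) ≠ 0 := by positivity
  have : (d * ‖w‖) ^ 2 + d ^ 2 = d ^ 2 * (‖w‖ ^ 2 + 1) := by ring
  rw [this]
  field_simp

lemma tendsto_integral_reg_kernel {φ : ℂ → ℝ} (hφ : Continuous φ) (hc : HasCompactSupport φ)
    {d : ℕ → ℝ} (hd : Tendsto d atTop (𝓝 0)) :
    Tendsto (fun n => ∫ w : ℂ, 2 / (‖w‖ ^ 2 + 1) ^ 2 * φ (d n • w)) atTop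
      (𝓝 (2 * Real.pi * φ 0)) := by
  obtain ⟨C, hC⟩ := hφ.bounded_above_of_compact_support hc
  rw [← integral_two_div_one_add_norm_sq_sq.2, ← integral_mul_const]
  refine tendsto_integral_of_dominated_convergence (fun w : ℂ => 2 / (‖w‖ ^ 2 + 1) ^ 2 * C)
    (fun n => ?_) (integral_two_div_one_add_norm_sq_sq.1.mul_const C) (fun n => ?_) ?_
  · exact (integral_two_div_one_add_norm_sq_sq.1.aestronglyMeasurable.mul
      (by fun_prop : Continuous fun w => φ (d n • w)).aestronglyMeasurable)
  · refine .of_forall fun w => ?_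
    rw [norm_mul, Real.norm_of_nonneg (by positivity)]
    gcongr
    exact hC _
  · refine .of_forall fun w => ?_
    refine Tendsto.const_mul _ ((hφ.tendsto 0).comp ?_)
    simpa using hd.smul_const w

lemma tendsto_integral_log_reg {ψ : ℂ → ℝ} (hψ : Continuous ψ) (hc : HasCompactSupport ψ)
    {d : ℕ → ℝ} (hd : Tendsto d atTop (𝓝 0)) (hd0 : ∀ n, 0 < d n) (hd1 : ∀ n, d n ≤ 1) :
    Tendsto (fun n => ∫ w : ℂ, Real.log (‖w‖ ^ 2 + d n ^ 2) / 2 * ψ w) atTop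
      (𝓝 (∫ w : ℂ, Real.log ‖w‖ * ψ w)) := by
  have i1 : Integrable (fun w : ℂ => |Real.log ‖w‖| * |ψ w|) := by
    have := (locallyIntegrable_log_norm.integrable_smul_right_of_hasCompactSupport hψ hc).abs
    simpa [abs_mul] using this
  have i2 : Integrable (fun w : ℂ => Real.log (‖w‖ ^ 2 + 1 ^ 2) / 2 * |ψ w|) :=
    ((continuous_log_reg one_pos).mul hψ.abs).integrable_of_hasCompactSupport hc.norm.mul_left
  -- For 0 < d ≤ 1 the regularized logarithm lies between log|w| and its value at d = 1, so these
  -- two bound it uniformly.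
  refine tendsto_integral_of_dominated_convergence
    (fun w : ℂ => |Real.log ‖w‖| * |ψ w| + Real.log (‖w‖ ^ 2 + 1 ^ 2) / 2 * |ψ w|)
    (fun n => ((continuous_log_reg (hd0 n)).mul hψ).aestronglyMeasurable) (i1.add i2)
    (fun n => ?_) ?_
  · have h0 : ∀ᵐ w : ℂ, w ≠ 0 := by simp [ae_iff]
    filter_upwards [h0] with w hw
    have hw : 0 < ‖w‖ := norm_pos_iff.2 hw
    rw [norm_mul, ← add_mul, Real.norm_eq_abs, Real.norm_eq_abs]
    gcongr
    have u1 : 2 * Real.log ‖w‖ ≤ Real.log (‖w‖ ^ 2 + d n ^ 2) := by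
      have := Real.log_le_log (by positivity : 0 < ‖w‖ ^ 2)
        (by nlinarith [hd0 n] : ‖w‖ ^ 2 ≤ ‖w‖ ^ 2 + d n ^ 2)
      simpa [Real.log_pow] using this
    have u2 : Real.log (‖w‖ ^ 2 + d n ^ 2) ≤ Real.log (‖w‖ ^ 2 + 1 ^ 2) := by
      refine Real.log_le_log (by positivity) ?_
      have := pow_le_pow_left₀ (hd0 n).le (hd1 n) 2
      linarith
    have u3 : 0 ≤ Real.log (‖w‖ ^ 2 + 1 ^ 2) := Real.log_nonneg (by nlinarith)
    have u4 := neg_abs_le (Real.log ‖w‖)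
    have u5 := abs_nonneg (Real.log ‖w‖)
    generalize Real.log (‖w‖ ^ 2 + d n ^ 2) = a at *
    generalize Real.log (‖w‖ ^ 2 + 1 ^ 2) = b at *
    rw [abs_le]
    constructor <;> linarith
  · have h0 : ∀ᵐ w : ℂ, w ≠ 0 := by simp [ae_iff]
    filter_upwards [h0] with w hw
    have hw : 0 < ‖w‖ := norm_pos_iff.2 hw
    refine Tendsto.mul_const _ ?_
    have : Real.log ‖w‖ = Real.log (‖w‖ ^ 2 + 0 ^ 2) / 2 := by
      simp [Real.log_pow]
    rw [this]
    refine (Tendsto.log (tendsto_const_nhds.add (hd.pow 2)) ?_).div_const 2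
    positivity

lemma integral_log_norm_mul_lap {φ : ℂ → ℝ} (hφ : ContDiff ℝ 2 φ) (hc : HasCompactSupport φ) :
    ∫ w : ℂ, Real.log ‖w‖ * lap φ w = 2 * Real.pi * φ 0 := by
  have hd := tendsto_one_div_add_atTop_nhds_zero_nat (𝕜 := ℝ)
  have hd0 : ∀ n : ℕ, (0 : ℝ) < 1 / ((n : ℝ) + 1) := fun n => by positivity
  have hd1 : ∀ n : ℕ, 1 / ((n : ℝ) + 1) ≤ 1 := fun n => by
    rw [div_le_one (by positivity)]; simp
  refine tendsto_nhds_unique (tendsto_integral_log_reg (lap_continuous hφ)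
    (lap_hasCompactSupport hc) hd hd0 hd1) ?_
  simp only [integral_log_reg_mul_lap hφ hc (hd0 _), integral_reg_kernel_mul (hd0 _)]
  exact tendsto_integral_reg_kernel hφ.continuous hc hd

/-- Green's representation of a test function by the logarithmic potential of its Laplacian. -/
lemma integral_log_norm_sub_mul_lap {φ : ℂ → ℝ} (hφ : ContDiff ℝ 2 φ) (hc : HasCompactSupport φ)
    (z : ℂ) : ∫ w : ℂ, Real.log ‖z - w‖ * lap φ w = 2 * Real.pi * φ z := by
  have h := integral_log_norm_mul_lap (φ := fun w => φ (z + w))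
    (hφ.comp (contDiff_const.add contDiff_id))
    (hc.comp_homeomorph (Homeomorph.addLeft z))
  have e : ∀ w, lap (fun w => φ (z + w)) w = lap φ (z + w) := fun w => by
    simp only [lap, fderiv_comp_add_left]
    rw [fderiv_comp_add_left (f := fun y => fderiv ℝ φ y 1),
      fderiv_comp_add_left (f := fun y => fderiv ℝ φ y Complex.I)]
  simp only [e, add_zero] at h
  rw [← h, ← integral_add_left_eq_self _ z]
  simp

lemma integral_mul_lap {φ : ℂ → ℝ} (hφ : ContDiff ℝ 2 φ) (hc : HasCompactSupport φ) :
    ∫ w, φ w * lap φ w = - dirichletEnergy φ := by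
  have hd1 : ∀ v : ℂ, ContDiff ℝ 1 (fun y => fderiv ℝ φ y v) := fun v =>
    contDiff_fderiv_apply (n := 2) (m := 1) hφ (by norm_num) v
  have key : ∀ v : ℂ, ∫ w, φ w * fderiv ℝ (fun y => fderiv ℝ φ y v) w v
      = - ∫ w, (fderiv ℝ φ w v) ^ 2 := fun v => by
    simp only [sq]
    exact integral_mul_fderiv_of_hasLineDerivAt (hd1 v) (hasCompactSupport_fderiv_apply hc v)
      hφ.continuous (hd1 v).continuous v
      fun w => ((hφ.differentiable (by norm_num)) w).hasFDerivAt.hasLineDerivAt v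
  have i1 : ∀ v : ℂ, Integrable (fun w => φ w *
      fderiv ℝ (fun y => fderiv ℝ φ y v) w v) := fun v =>
    (hφ.continuous.mul (((hd1 v).continuous_fderiv (by norm_num)).clm_apply
      continuous_const)).integrable_of_hasCompactSupport hc.mul_right
  have i2 : ∀ v : ℂ, Integrable (fun w => (fderiv ℝ φ w v) ^ 2) := fun v => by
    simp only [sq]
    exact ((hd1 v).continuous.mul (hd1 v).continuous).integrable_of_hasCompactSupport
      (hasCompactSupport_fderiv_apply hc v).mul_left
  simp only [lap, mul_add, dirichletEnergy]
  rw [integral_add (i1 1) (i1 Complex.I), key, key, integral_add (i2 1) (i2 Complex.I), neg_add]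

/-- Neutrality of Δφ dm: adding a multiple of it to ν - μ keeps the total mass zero. -/
lemma integral_lap {φ : ℂ → ℝ} (hφ : ContDiff ℝ 2 φ) (hc : HasCompactSupport φ) :
    ∫ w, lap φ w = 0 := by
  have hd1 : ∀ v : ℂ, ContDiff ℝ 1 (fun y => fderiv ℝ φ y v) := fun v =>
    contDiff_fderiv_apply (n := 2) (m := 1) hφ (by norm_num) v
  have key : ∀ v : ℂ, ∫ w, fderiv ℝ (fun y => fderiv ℝ φ y v) w v = 0 := fun v => by
    have := integral_mul_fderiv_of_hasLineDerivAt (hd1 v) (hasCompactSupport_fderiv_apply hc v)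
      (F := fun _ => 1) (F' := fun _ => 0) continuous_const continuous_const v
      fun w => by simpa using (hasFDerivAt_const (1 : ℝ) w).hasLineDerivAt (𝕜 := ℝ) v
    simpa using this
  have i1 : ∀ v : ℂ, Integrable (fun w =>
      fderiv ℝ (fun y => fderiv ℝ φ y v) w v) := fun v =>
    (((hd1 v).continuous_fderiv (by norm_num)).clm_apply
      continuous_const).integrable_of_hasCompactSupport
      (hasCompactSupport_fderiv_apply (hasCompactSupport_fderiv_apply hc v) v)
  simp only [lap]
  rw [integral_add (i1 1) (i1 Complex.I), key, key, add_zero]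

/-! ### Frullani's integral for the logarithm. -/

section Frullani

/-- The truncation `∫_{-N}^N (exp (-e^y a) - exp (-e^y)) dy` of the Frullani integral for
`-log a`. -/
def frullani (N a : ℝ) : ℝ :=
  ∫ y in (-N)..N, (Real.exp (-(Real.exp y * a)) - Real.exp (-Real.exp y))

lemma continuous_exp_neg_exp : Continuous (fun y : ℝ => Real.exp (-Real.exp y)) := by fun_prop

/-- Shifting y by log a turns the first integrand into the second over a shifted window; everything
cancels except two end windows of length |log a|. As N → ∞ the right one tends to 0 and the left one
to log a. -/
lemma frullani_eq {N a : ℝ} (ha : 0 < a) :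
    frullani N a = (∫ y in (0 : ℝ)..Real.log a, Real.exp (-Real.exp (y + N)))
      - ∫ y in (0 : ℝ)..Real.log a, Real.exp (-Real.exp (y + -N)) := by
  have hi : ∀ u v : ℝ, IntervalIntegrable (fun y : ℝ => Real.exp (-Real.exp y)) volume u v :=
    fun u v => continuous_exp_neg_exp.intervalIntegrable u v
  have e : ∀ y, Real.exp (-(Real.exp y * a)) = Real.exp (-Real.exp (y + Real.log a)) := fun y => by
    rw [Real.exp_add, Real.exp_log ha]
  simp only [frullani, e]
  rw [intervalIntegral.integral_sub (by apply Continuous.intervalIntegrable; fun_prop) (hi _ _),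
    intervalIntegral.integral_comp_add_right (fun y => Real.exp (-Real.exp y)),
    intervalIntegral.integral_comp_add_right (fun y => Real.exp (-Real.exp y)),
    intervalIntegral.integral_comp_add_right (fun y => Real.exp (-Real.exp y))]
  have h1 := intervalIntegral.integral_add_adjacent_intervals
    (hi (-N) (-N + Real.log a)) (hi (-N + Real.log a) (N + Real.log a))
  have h2 := intervalIntegral.integral_add_adjacent_intervals
    (hi (-N) N) (hi N (N + Real.log a))
  rw [zero_add, zero_add, add_comm (Real.log a) N, add_comm (Real.log a) (-N)]
  linarith

/-- Each end window has length |log a| and integrand at most 1. Uniformity in N makes this the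
dominating function later. -/
lemma abs_frullani_le {N a : ℝ} (ha : 0 < a) : |frullani N a| ≤ 2 * |Real.log a| := by
  have h : ∀ M : ℝ, |∫ y in (0 : ℝ)..Real.log a, Real.exp (-Real.exp (y + M))| ≤ |Real.log a| :=
    fun M => by
      have := intervalIntegral.norm_integral_le_of_norm_le_const (a := 0) (b := Real.log a)
        (f := fun y => Real.exp (-Real.exp (y + M))) (C := 1) fun y _ => by
          rw [Real.norm_of_nonneg (Real.exp_nonneg _), Real.exp_le_one_iff]
          exact neg_nonpos.2 (Real.exp_nonneg _)
      simpa using this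
  rw [frullani_eq ha]
  refine (abs_sub _ _).trans ?_
  linarith [h N, h (-N)]

lemma tendsto_integral_exp_neg_exp {l : Filter ℝ} [l.IsCountablyGenerated] {b c : ℝ}
    (h : ∀ y, Tendsto (fun N : ℝ => Real.exp (-Real.exp (y + N))) l (𝓝 c)) :
    Tendsto (fun N => ∫ y in (0 : ℝ)..b, Real.exp (-Real.exp (y + N))) l (𝓝 (b * c)) := by
  have := intervalIntegral.tendsto_integral_filter_of_dominated_convergence (μ := volume)
    (a := 0) (b := b) (l := l) (F := fun N y => Real.exp (-Real.exp (y + N))) (f := fun _ => c)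
    (fun _ => 1) (.of_forall fun N => by
      apply Continuous.aestronglyMeasurable; fun_prop)
    (.of_forall fun N => .of_forall fun y _ => by
      rw [Real.norm_of_nonneg (Real.exp_nonneg _), Real.exp_le_one_iff]
      exact neg_nonpos.2 (Real.exp_nonneg _))
    (by simp) (.of_forall fun y _ => h y)
  simpa using this

lemma tendsto_frullani {a : ℝ} (ha : 0 < a) :
    Tendsto (fun N => frullani N a) atTop (𝓝 (-Real.log a)) := by
  simp only [frullani_eq ha]
  have h1 : Tendsto (fun N => ∫ y in (0 : ℝ)..Real.log a, Real.exp (-Real.exp (y + N))) atTop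
      (𝓝 (Real.log a * 0)) :=
    tendsto_integral_exp_neg_exp fun y => Real.tendsto_exp_neg_atTop_nhds_zero.comp
      (Real.tendsto_exp_atTop.comp (tendsto_atTop_add_const_left _ _ tendsto_id))
  have h2 : Tendsto (fun N => ∫ y in (0 : ℝ)..Real.log a, Real.exp (-Real.exp (y + N))) atBot
      (𝓝 (Real.log a * 1)) :=
    tendsto_integral_exp_neg_exp fun y => by
      have : Tendsto (fun N : ℝ => -Real.exp (y + N)) atBot (𝓝 (-0)) :=
        (Real.tendsto_exp_atBot.comp (tendsto_atBot_add_const_left _ _ tendsto_id)).neg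
      simpa [Function.comp_def] using (Real.continuous_exp.tendsto _).comp this
  simpa using h1.sub (h2.comp tendsto_neg_atTop_atBot)

end Frullani

/-! ### Positive definiteness of Gaussian kernels and negativity of the logarithmic kernel. -/

section Gaussian

/-- The unnormalized Gaussian potential of the weighted measure `f τ`. -/
def gaussPot (τ : Measure ℂ) (f : ℂ → ℝ) (s : ℝ) (u : ℂ) : ℝ :=
  ∫ z, f z * Real.exp (-(2 * s) * ‖z - u‖ ^ 2) ∂τ

/-- The Gaussian interaction of two weighted measures. -/
def gaussEnergy (τ₁ τ₂ : Measure ℂ) (f₁ f₂ : ℂ → ℝ) (s : ℝ) : ℝ :=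
  ∫ q : ℂ × ℂ, f₁ q.1 * f₂ q.2 * Real.exp (-(s * ‖q.1 - q.2‖ ^ 2)) ∂(τ₁.prod τ₂)

lemma integrable_gauss {b : ℝ} (hb : 0 < b) :
    Integrable (fun u : ℂ => Real.exp (-b * ‖u‖ ^ 2)) := by
  -- A non-integrable function would have the default integral 0, whereas the Gaussian integral is
  -- positive.
  refine not_imp_comm.1 integral_undef ?_
  rw [GaussianFourier.integral_rexp_neg_mul_sq_norm hb]
  positivity

/-- The parallelogram law about the midpoint of z and w. -/
lemma gauss_mul_gauss (s : ℝ) (z w u : ℂ) :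
    Real.exp (-(2 * s) * ‖z - u‖ ^ 2) * Real.exp (-(2 * s) * ‖w - u‖ ^ 2)
      = Real.exp (-(s * ‖z - w‖ ^ 2)) * Real.exp (-(4 * s) * ‖(z + w) / 2 - u‖ ^ 2) := by
  rw [← Real.exp_add, ← Real.exp_add]
  congr 1
  simp only [← Complex.normSq_eq_norm_sq, Complex.normSq_apply, Complex.sub_re, Complex.sub_im,
    Complex.add_re, Complex.add_im, Complex.div_ofNat_re, Complex.div_ofNat_im]
  ring

lemma integral_gauss_mul_gauss (s : ℝ) (z w : ℂ) :
    ∫ u : ℂ, Real.exp (-(2 * s) * ‖z - u‖ ^ 2) * Real.exp (-(2 * s) * ‖w - u‖ ^ 2)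
      = Real.exp (-(s * ‖z - w‖ ^ 2)) * ∫ u : ℂ, Real.exp (-(4 * s) * ‖u‖ ^ 2) := by
  simp only [gauss_mul_gauss]
  rw [integral_const_mul, integral_sub_left_eq_self
    (fun u : ℂ => Real.exp (-(4 * s) * ‖u‖ ^ 2)) volume]

variable {τ₁ τ₂ : Measure ℂ} [IsFiniteMeasure τ₁] [IsFiniteMeasure τ₂] {f₁ f₂ : ℂ → ℝ} {C : ℝ}

/-- A Gaussian is, up to a positive constant, the convolution square of a narrower one, so the
interaction is an L² inner product of potentials. -/
lemma gaussEnergy_eq (hf₁ : Measurable f₁) (hf₂ : Measurable f₂) (h₁ : ∀ z, |f₁ z| ≤ C)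
    (h₂ : ∀ z, |f₂ z| ≤ C) {s : ℝ} (hs : 0 < s) :
    Integrable (fun u => gaussPot τ₁ f₁ s u * gaussPot τ₂ f₂ s u) ∧
    gaussEnergy τ₁ τ₂ f₁ f₂ s * (∫ u : ℂ, Real.exp (-(4 * s) * ‖u‖ ^ 2))
      = ∫ u, gaussPot τ₁ f₁ s u * gaussPot τ₂ f₂ s u := by
  have hC : 0 ≤ C := (abs_nonneg _).trans (h₁ 0)
  set g : ℂ → ℝ := fun u => Real.exp (-(2 * s) * ‖u‖ ^ 2) with hg
  have gi : Integrable g := integrable_gauss (by positivity)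
  have gc : Continuous g := by fun_prop
  have g1 : ∀ u, |g u| ≤ 1 := fun u => by
    rw [abs_of_nonneg (Real.exp_nonneg _), Real.exp_le_one_iff]
    have : 0 ≤ 2 * s * ‖u‖ ^ 2 := by positivity
    linarith
  -- One Gaussian factor already gives integrability in u against the finite measures; all remaining
  -- factors are bounded.
  have I0 : Integrable (fun x : (ℂ × ℂ) × ℂ => g (x.1.2 - x.2)) ((τ₁.prod τ₂).prod volume) := by
    rw [integrable_prod_iff (by apply Continuous.aestronglyMeasurable; fun_prop)]
    refine ⟨.of_forall fun q => gi.comp_sub_left q.2, ?_⟩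
    have : ∀ q : ℂ × ℂ, ∫ u, ‖g (q.2 - u)‖ = ∫ u, ‖g u‖ := fun q =>
      integral_sub_left_eq_self (fun u => ‖g u‖) volume q.2
    simp only [this]
    exact integrable_const _
  have I1 : Integrable (fun x : (ℂ × ℂ) × ℂ => (f₁ x.1.1 * f₂ x.1.2 * g (x.1.1 - x.2)) *
      g (x.1.2 - x.2)) ((τ₁.prod τ₂).prod volume) := by
    refine I0.bdd_mul (c := C * C * 1) ?_ (.of_forall fun x => ?_)
    · apply Measurable.aestronglyMeasurable
      have := gc.measurable
      fun_prop
    · rw [norm_mul, norm_mul]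
      gcongr
      · exact h₁ _
      · exact h₂ _
      · exact g1 _
  have e1 : ∀ u, ∫ q : ℂ × ℂ, (f₁ q.1 * f₂ q.2 * g (q.1 - u)) * g (q.2 - u) ∂(τ₁.prod τ₂)
      = gaussPot τ₁ f₁ s u * gaussPot τ₂ f₂ s u := fun u => by
    simp only [gaussPot]
    rw [← integral_prod_mul (fun z => f₁ z * g (z - u)) (fun z => f₂ z * g (z - u))]
    refine integral_congr_ae (.of_forall fun q => ?_)
    simp only
    ring
  have e2 : ∀ q : ℂ × ℂ, ∫ u, (f₁ q.1 * f₂ q.2 * g (q.1 - u)) * g (q.2 - u)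
      = f₁ q.1 * f₂ q.2 * Real.exp (-(s * ‖q.1 - q.2‖ ^ 2)) *
        ∫ u : ℂ, Real.exp (-(4 * s) * ‖u‖ ^ 2) := fun q => by
    simp only [mul_assoc]
    rw [integral_const_mul, integral_const_mul]
    congr 2
    have := integral_gauss_mul_gauss s q.1 q.2
    simpa only [hg, mul_assoc] using this
  constructor
  · simpa only [e1] using I1.integral_prod_right
  · rw [gaussEnergy, ← integral_mul_const]
    simp only [← e2, ← e1]
    exact integral_integral_swap (f := fun (q : ℂ × ℂ) u => (f₁ q.1 * f₂ q.2 * g (q.1 - u)) * g (q.2 - u)) I1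

lemma integrable_weights (hf₁ : Measurable f₁) (hf₂ : Measurable f₂) (h₁ : ∀ z, |f₁ z| ≤ C)
    (h₂ : ∀ z, |f₂ z| ≤ C) : Integrable (fun q : ℂ × ℂ => f₁ q.1 * f₂ q.2) (τ₁.prod τ₂) := by
  refine Integrable.of_bound (C := C * C) (by fun_prop) (.of_forall fun q => ?_)
  rw [norm_mul]
  have hC : 0 ≤ C := (abs_nonneg _).trans (h₁ 0)
  gcongr
  · exact h₁ _
  · exact h₂ _

lemma integrable_weights_mul_gauss (hf₁ : Measurable f₁) (hf₂ : Measurable f₂)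
    (h₁ : ∀ z, |f₁ z| ≤ C) (h₂ : ∀ z, |f₂ z| ≤ C) {s : ℝ} (hs : 0 ≤ s) :
    Integrable (fun q : ℂ × ℂ => f₁ q.1 * f₂ q.2 * Real.exp (-(s * ‖q.1 - q.2‖ ^ 2)))
      (τ₁.prod τ₂) := by
  refine (integrable_weights hf₁ hf₂ h₁ h₂).mul_bdd (c := 1)
    (by apply Continuous.aestronglyMeasurable; fun_prop) (.of_forall fun q => ?_)
  rw [Real.norm_of_nonneg (Real.exp_nonneg _), Real.exp_le_one_iff]
  have : 0 ≤ s * ‖q.1 - q.2‖ ^ 2 := by positivity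
  linarith

/-- Fubini on a bounded range of y. The constant part of the integrand yields a product of masses,
which neutrality later removes. -/
lemma integral_weights_mul_frullani (hf₁ : Measurable f₁) (hf₂ : Measurable f₂)
    (h₁ : ∀ z, |f₁ z| ≤ C) (h₂ : ∀ z, |f₂ z| ≤ C) {N : ℝ} (hN : 0 ≤ N) :
    AEStronglyMeasurable (fun q : ℂ × ℂ => f₁ q.1 * f₂ q.2 * frullani N (‖q.1 - q.2‖ ^ 2))
      (τ₁.prod τ₂) ∧
    IntegrableOn (fun y => gaussEnergy τ₁ τ₂ f₁ f₂ (Real.exp y)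
      - Real.exp (-Real.exp y) * ((∫ z, f₁ z ∂τ₁) * ∫ z, f₂ z ∂τ₂)) (Ioc (-N) N) ∧
    ∫ q : ℂ × ℂ, f₁ q.1 * f₂ q.2 * frullani N (‖q.1 - q.2‖ ^ 2) ∂(τ₁.prod τ₂)
      = ∫ y in Ioc (-N) N, (gaussEnergy τ₁ τ₂ f₁ f₂ (Real.exp y)
      - Real.exp (-Real.exp y) * ((∫ z, f₁ z ∂τ₁) * ∫ z, f₂ z ∂τ₂)) := by
  have hC : 0 ≤ C := (abs_nonneg _).trans (h₁ 0)
  have I1 : Integrable (fun x : (ℂ × ℂ) × ℝ => f₁ x.1.1 * f₂ x.1.2 *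
      (Real.exp (-(Real.exp x.2 * ‖x.1.1 - x.1.2‖ ^ 2)) - Real.exp (-Real.exp x.2)))
      ((τ₁.prod τ₂).prod (volume.restrict (Ioc (-N) N))) := by
    refine Integrable.of_bound (C := C * C * (1 + 1)) (by fun_prop) (.of_forall fun x => ?_)
    rw [norm_mul, norm_mul]
    gcongr
    · exact h₁ _
    · exact h₂ _
    · refine (norm_sub_le _ _).trans (add_le_add ?_ ?_) <;>
        rw [Real.norm_of_nonneg (Real.exp_nonneg _), Real.exp_le_one_iff] <;>
        exact neg_nonpos.2 (by positivity)
  have e1 : ∀ q : ℂ × ℂ, f₁ q.1 * f₂ q.2 * frullani N (‖q.1 - q.2‖ ^ 2)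
      = ∫ y in Ioc (-N) N, f₁ q.1 * f₂ q.2 *
      (Real.exp (-(Real.exp y * ‖q.1 - q.2‖ ^ 2)) - Real.exp (-Real.exp y)) := fun q => by
    rw [integral_const_mul, frullani, intervalIntegral.integral_of_le (by linarith)]
  have e2 : ∀ y : ℝ, ∫ q : ℂ × ℂ, f₁ q.1 * f₂ q.2 *
      (Real.exp (-(Real.exp y * ‖q.1 - q.2‖ ^ 2)) - Real.exp (-Real.exp y)) ∂(τ₁.prod τ₂)
      = gaussEnergy τ₁ τ₂ f₁ f₂ (Real.exp y)
      - Real.exp (-Real.exp y) * ((∫ z, f₁ z ∂τ₁) * ∫ z, f₂ z ∂τ₂) := fun y => by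
    simp only [mul_sub]
    rw [integral_sub (integrable_weights_mul_gauss hf₁ hf₂ h₁ h₂ (Real.exp_nonneg y))
      ((integrable_weights hf₁ hf₂ h₁ h₂).mul_const _), integral_mul_const, integral_prod_mul,
      gaussEnergy]
    ring
  simp only [e1, ← e2]
  exact ⟨I1.integral_prod_left.aestronglyMeasurable, I1.integral_prod_right,
    integral_integral_swap (f := fun (q : ℂ × ℂ) y => f₁ q.1 * f₂ q.2 *
      (Real.exp (-(Real.exp y * ‖q.1 - q.2‖ ^ 2)) - Real.exp (-Real.exp y))) I1⟩

/-- The factor -2 appears because the Frullani integral is evaluated at the squared distance. -/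
lemma tendsto_integral_weights_mul_frullani (hf₁ : Measurable f₁) (hf₂ : Measurable f₂)
    (h₁ : ∀ z, |f₁ z| ≤ C) (h₂ : ∀ z, |f₂ z| ≤ C)
    (hne : ∀ᵐ q : ℂ × ℂ ∂(τ₁.prod τ₂), q.1 ≠ q.2)
    (hlog : Integrable (fun q : ℂ × ℂ => Real.log ‖q.1 - q.2‖) (τ₁.prod τ₂)) :
    Tendsto (fun N : ℕ => ∫ q : ℂ × ℂ, f₁ q.1 * f₂ q.2 *
        frullani N (‖q.1 - q.2‖ ^ 2) ∂(τ₁.prod τ₂)) atTop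
      (𝓝 (-2 * ∫ q : ℂ × ℂ, f₁ q.1 * f₂ q.2 * Real.log ‖q.1 - q.2‖ ∂(τ₁.prod τ₂))) := by
  have hC : 0 ≤ C := (abs_nonneg _).trans (h₁ 0)
  rw [← integral_const_mul]
  refine tendsto_integral_of_dominated_convergence
    (fun q : ℂ × ℂ => C * C * (4 * |Real.log ‖q.1 - q.2‖|))
    (fun N => (integral_weights_mul_frullani hf₁ hf₂ h₁ h₂ N.cast_nonneg).1)
    ((hlog.abs.const_mul 4).const_mul _) (fun N => ?_) ?_
  · filter_upwards [hne] with q hq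
    have hq : 0 < ‖q.1 - q.2‖ := norm_pos_iff.2 (sub_ne_zero.2 hq)
    rw [norm_mul, norm_mul]
    gcongr
    · exact h₁ _
    · exact h₂ _
    · refine (abs_frullani_le (by positivity)).trans (le_of_eq ?_)
      rw [Real.log_pow, abs_mul]
      norm_num
      ring
  · filter_upwards [hne] with q hq
    have hq : 0 < ‖q.1 - q.2‖ := norm_pos_iff.2 (sub_ne_zero.2 hq)
    have := ((tendsto_frullani (a := ‖q.1 - q.2‖ ^ 2) (by positivity)).comp
      tendsto_natCast_atTop_atTop).const_mul (f₁ q.1 * f₂ q.2)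
    refine this.congr' .rfl |>.trans (le_of_eq ?_)
    congr 1
    rw [Real.log_pow]
    push_cast
    ring

end Gaussian

/-- The logarithmic kernel is conditionally negative definite on weighted measures of finite
energy and total mass zero. -/
theorem sum_integral_log_nonpos {ι : Type*} [Fintype ι] (τ : ι → Measure ℂ)
    [∀ i, IsFiniteMeasure (τ i)] (f : ι → ℂ → ℝ) {C : ℝ} (hf : ∀ i, Measurable (f i))
    (hC : ∀ i z, |f i z| ≤ C) (hne : ∀ i j, ∀ᵐ q : ℂ × ℂ ∂((τ i).prod (τ j)), q.1 ≠ q.2)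
    (hlog : ∀ i j, Integrable (fun q : ℂ × ℂ => Real.log ‖q.1 - q.2‖) ((τ i).prod (τ j)))
    (h0 : ∑ i, ∫ z, f i z ∂(τ i) = 0) :
    ∑ i, ∑ j, ∫ q : ℂ × ℂ, f i q.1 * f j q.2 * Real.log ‖q.1 - q.2‖ ∂((τ i).prod (τ j)) ≤ 0 := by
  have hlim : Tendsto (fun N : ℕ => ∑ i, ∑ j, ∫ q : ℂ × ℂ, f i q.1 * f j q.2 *
        frullani N (‖q.1 - q.2‖ ^ 2) ∂((τ i).prod (τ j))) atTop
      (𝓝 (∑ i, ∑ j, -2 * ∫ q : ℂ × ℂ, f i q.1 * f j q.2 *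
        Real.log ‖q.1 - q.2‖ ∂((τ i).prod (τ j)))) :=
    tendsto_finsetSum _ fun i _ => tendsto_finsetSum _ fun j _ =>
      tendsto_integral_weights_mul_frullani (hf i) (hf j) (hC i) (hC j) (hne i j) (hlog i j)
  have hpos : ∀ N : ℕ, 0 ≤ ∑ i, ∑ j, ∫ q : ℂ × ℂ, f i q.1 * f j q.2 *
        frullani N (‖q.1 - q.2‖ ^ 2) ∂((τ i).prod (τ j)) := fun N => by
    have P := fun i j => integral_weights_mul_frullani (τ₁ := τ i) (τ₂ := τ j) (hf i) (hf j)
      (hC i) (hC j) (N := N) N.cast_nonneg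
    have e : ∑ i, ∑ j, ∫ q : ℂ × ℂ, f i q.1 * f j q.2 *
        frullani N (‖q.1 - q.2‖ ^ 2) ∂((τ i).prod (τ j))
        = ∫ y in Ioc (-(N : ℝ)) N, ∑ i, ∑ j, (gaussEnergy (τ i) (τ j) (f i) (f j) (Real.exp y)
          - Real.exp (-Real.exp y) * ((∫ z, f i z ∂(τ i)) * ∫ z, f j z ∂(τ j))) := by
      rw [integral_finsetSum _ fun i _ => integrable_finsetSum _ fun j _ => (P i j).2.1]
      refine Finset.sum_congr rfl fun i _ => ?_
      rw [integral_finsetSum _ fun j _ => (P i j).2.1]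
      exact Finset.sum_congr rfl fun j _ => (P i j).2.2
    rw [e]
    refine integral_nonneg fun y => ?_
    -- The products of masses sum to the square of the total mass, which is zero.
    have e1 : ∑ i, ∑ j, (gaussEnergy (τ i) (τ j) (f i) (f j) (Real.exp y)
          - Real.exp (-Real.exp y) * ((∫ z, f i z ∂(τ i)) * ∫ z, f j z ∂(τ j)))
        = ∑ i, ∑ j, gaussEnergy (τ i) (τ j) (f i) (f j) (Real.exp y) := by
      simp only [Finset.sum_sub_distrib, ← Finset.mul_sum, ← Finset.sum_mul, h0]
      ring
    have hs := Real.exp_pos y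
    have G := fun i j => gaussEnergy_eq (τ₁ := τ i) (τ₂ := τ j) (hf i) (hf j) (hC i) (hC j) hs
    have hc : 0 < ∫ u : ℂ, Real.exp (-(4 * Real.exp y) * ‖u‖ ^ 2) := by
      rw [GaussianFourier.integral_rexp_neg_mul_sq_norm (by positivity)]
      positivity
    -- The double sum of inner products is the squared L² norm of the total Gaussian potential.
    have e2 : (∑ i, ∑ j, gaussEnergy (τ i) (τ j) (f i) (f j) (Real.exp y)) *
        (∫ u : ℂ, Real.exp (-(4 * Real.exp y) * ‖u‖ ^ 2))
        = ∫ u, (∑ i, gaussPot (τ i) (f i) (Real.exp y) u) ^ 2 := by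
      simp only [sq (Finset.sum _ _), Finset.sum_mul_sum]
      simp only [Finset.sum_mul]
      rw [integral_finsetSum _ fun i _ => integrable_finsetSum _ fun j _ => (G i j).1]
      refine Finset.sum_congr rfl fun i _ => ?_
      rw [integral_finsetSum _ fun j _ => (G i j).1]
      exact Finset.sum_congr rfl fun j _ => (G i j).2
    simp only [Pi.zero_apply]
    rw [e1]
    refine nonneg_of_mul_nonneg_left ?_ hc
    rw [e2]
    exact integral_nonneg fun u => sq_nonneg _
  have := ge_of_tendsto' hlim hpos
  simp only [← Finset.mul_sum] at this
  linarith

/-! ### Integrability of the logarithmic kernel and nullity of the diagonal. -/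

section Kernel

/-- Measures whose logarithmic potential converges absolutely and locally uniformly bounded. -/
def HasBoundedLogPotential (τ : Measure ℂ) : Prop :=
  (∀ z, Integrable (fun w => Real.log ‖z - w‖) τ) ∧
    ∀ M : ℝ, ∃ C : ℝ, ∀ z : ℂ, ‖z‖ ≤ M → ∫ w, |Real.log ‖z - w‖| ∂τ ≤ C

lemma HasBoundedLogPotential.add {τ₁ τ₂ : Measure ℂ} (h₁ : HasBoundedLogPotential τ₁)
    (h₂ : HasBoundedLogPotential τ₂) : HasBoundedLogPotential (τ₁ + τ₂) := by
  refine ⟨fun z => (h₁.1 z).add_measure (h₂.1 z), fun M => ?_⟩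
  obtain ⟨C₁, hC₁⟩ := h₁.2 M
  obtain ⟨C₂, hC₂⟩ := h₂.2 M
  refine ⟨C₁ + C₂, fun z hz => ?_⟩
  rw [integral_add_measure (h₁.1 z).abs (h₂.1 z).abs]
  exact add_le_add (hC₁ z hz) (hC₂ z hz)

lemma HasBoundedLogPotential.smul {τ : Measure ℂ} (h : HasBoundedLogPotential τ) {c : ENNReal}
    (hc : c ≠ ⊤) : HasBoundedLogPotential (c • τ) := by
  refine ⟨fun z => (h.1 z).smul_measure hc, fun M => ?_⟩
  obtain ⟨C, hC⟩ := h.2 M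
  refine ⟨c.toReal * C, fun z hz => ?_⟩
  rw [integral_smul_measure, smul_eq_mul]
  exact mul_le_mul_of_nonneg_left (hC z hz) ENNReal.toReal_nonneg

lemma HasBoundedLogPotential.mono {τ τ' : Measure ℂ} (h : HasBoundedLogPotential τ)
    (hle : τ' ≤ τ) : HasBoundedLogPotential τ' := by
  refine ⟨fun z => (h.1 z).mono_measure hle, fun M => ?_⟩
  obtain ⟨C, hC⟩ := h.2 M
  exact ⟨C, fun z hz => (integral_mono_measure hle (.of_forall fun _ => abs_nonneg _)
    (h.1 z).abs).trans (hC z hz)⟩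

lemma measurable_log_norm_sub : Measurable (fun q : ℂ × ℂ => Real.log ‖q.1 - q.2‖) := by
  fun_prop

/-- Regularity is asked of τ only; ρ may be any finite measure of bounded support, atoms included.
-/
lemma HasBoundedLogPotential.integrable_prod {ρ τ : Measure ℂ} [IsFiniteMeasure ρ] [SFinite τ]
    (h : HasBoundedLogPotential τ) {M : ℝ} (hM : ∀ᵐ z ∂ρ, ‖z‖ ≤ M) :
    Integrable (fun q : ℂ × ℂ => Real.log ‖q.1 - q.2‖) (ρ.prod τ) := by
  rw [integrable_prod_iff measurable_log_norm_sub.aestronglyMeasurable]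
  refine ⟨.of_forall h.1, ?_⟩
  obtain ⟨C, hC⟩ := h.2 M
  refine Integrable.of_bound (C := C)
    measurable_log_norm_sub.norm.aestronglyMeasurable.integral_prod_right' ?_
  filter_upwards [hM] with z hz
  rw [Real.norm_of_nonneg (integral_nonneg fun _ => norm_nonneg _)]
  exact hC z hz

lemma HasBoundedLogPotential.integrable_prod_swap {ρ τ : Measure ℂ} [IsFiniteMeasure ρ] [SFinite τ]
    (h : HasBoundedLogPotential τ) {M : ℝ} (hM : ∀ᵐ z ∂ρ, ‖z‖ ≤ M) :
    Integrable (fun q : ℂ × ℂ => Real.log ‖q.1 - q.2‖) (τ.prod ρ) := by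
  refine (h.integrable_prod hM).swap.congr (.of_forall fun q => ?_)
  simp [norm_sub_rev]

lemma ae_fst_ne_snd (ρ τ : Measure ℂ) [SFinite ρ] [SFinite τ] [NullSingletonClass τ] :
    ∀ᵐ q : ℂ × ℂ ∂(ρ.prod τ), q.1 ≠ q.2 := by
  refine (Measure.ae_prod_iff_ae_ae (p := fun q : ℂ × ℂ => q.1 ≠ q.2)
    (measurableSet_eq_fun measurable_fst measurable_snd).compl).2 ?_
  refine .of_forall fun z => ?_
  simp [ae_iff]

lemma ae_fst_ne_snd' (ρ τ : Measure ℂ) [SFinite ρ] [SFinite τ] [NullSingletonClass τ] :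
    ∀ᵐ q : ℂ × ℂ ∂(τ.prod ρ), q.1 ≠ q.2 := by
  have := (Measure.measurePreserving_swap (μ := τ) (ν := ρ)).quasiMeasurePreserving.ae
    (ae_fst_ne_snd ρ τ)
  filter_upwards [this] with q hq
  exact fun h => hq h.symm

end Kernel

/-! ### Logarithmic potential of a disk. -/

section Disk

lemma integral_closedBall_log_comp_sub (R : ℝ) (z : ℂ) (F : ℝ → ℝ) :
    ∫ w in Metric.closedBall (0 : ℂ) R, F ‖z - w‖ = ∫ w in Metric.closedBall z R, F ‖w‖ := by
  have mp : MeasurePreserving (fun w : ℂ => z - w) volume volume :=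
    Measure.measurePreserving_sub_left volume z
  rw [← mp.setIntegral_preimage_emb (Homeomorph.subLeft z).measurableEmbedding
    (fun w => F ‖w‖)]
  congr 2
  ext w
  simp [dist_eq_norm]

/-- After translation the singularity sits at 0 and the disk is contained in the fixed disk of
radius R + M. -/
lemma hasBoundedLogPotential_closedBall (R : ℝ) :
    HasBoundedLogPotential (volume.restrict (Metric.closedBall 0 R)) := by
  refine ⟨fun z => (locallyIntegrable_log_norm_sub z).integrableOn_isCompact
    (isCompact_closedBall _ _), fun M => ⟨∫ w in Metric.closedBall (0 : ℂ) (R + M), |Real.log ‖w‖|,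
    fun z hz => ?_⟩⟩
  rw [integral_closedBall_log_comp_sub R z (fun x => |Real.log x|)]
  refine setIntegral_mono_set (locallyIntegrable_log_norm.integrableOn_isCompact
    (isCompact_closedBall _ _)).abs (.of_forall fun _ => abs_nonneg _)
    (LE.le.eventuallyLE (Metric.closedBall_subset_closedBall' ?_))
  rw [dist_zero_right]
  linarith

lemma integral_closedBall_log_eq_of_norm_eq (R : ℝ) {z z' : ℂ} (h : ‖z‖ = ‖z'‖) :
    ∫ w in Metric.closedBall 0 R, Real.log ‖z - w‖
      = ∫ w in Metric.closedBall 0 R, Real.log ‖z' - w‖ := by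
  rcases eq_or_ne z' 0 with rfl | hz'
  · rw [norm_zero, norm_eq_zero] at h
    rw [h]
  have hc : ‖z / z'‖ = 1 := by rw [norm_div, h, div_self (norm_ne_zero_iff.2 hz')]
  let c : Circle := ⟨z / z', mem_sphere_zero_iff_norm.2 hc⟩
  have mp := (rotation c).measurePreserving
  rw [← mp.setIntegral_preimage_emb (rotation c).toHomeomorph.measurableEmbedding
    (fun w => Real.log ‖z - w‖)]
  have e : rotation c ⁻¹' Metric.closedBall 0 R = Metric.closedBall 0 R := by
    ext w
    simp only [mem_preimage, mem_closedBall_zero_iff, LinearIsometryEquiv.norm_map]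
  rw [e]
  refine setIntegral_congr_fun Metric.isClosed_closedBall.measurableSet fun w _ => ?_
  have : z - rotation c w = rotation c (z' - w) := by
    rw [map_sub]
    congr 1
    rw [rotation_apply]
    exact (div_mul_cancel₀ _ hz').symm
  simp only [this, LinearIsometryEquiv.norm_map]

lemma circleAverage_log_norm_sub_eq_log_max {r : ℝ} (hr : 0 < r) {w : ℂ} (hw : w ≠ 0) :
    Real.circleAverage (fun z => Real.log ‖z - w‖) 0 r = Real.log (max r ‖w‖) := by
  have hw : 0 < ‖w‖ := norm_pos_iff.2 hw
  rw [circleAverage_log_norm_sub_const_eq_log_radius_add_posLog hr.ne', zero_sub, norm_neg,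
    Real.posLog_eq_log_max_one (by positivity), ← Real.log_mul hr.ne' (by positivity),
    mul_max_of_nonneg _ _ hr.le, mul_one, mul_inv_cancel_left₀ hr.ne']

lemma HasBoundedLogPotential.integral_circleMap_swap {τ : Measure ℂ} [SFinite τ]
    (hb : HasBoundedLogPotential τ) (r : ℝ) :
    ∫ θ in Ioc 0 (2 * Real.pi), ∫ w, Real.log ‖circleMap 0 r θ - w‖ ∂τ
      = ∫ w, (∫ θ in Ioc 0 (2 * Real.pi), Real.log ‖circleMap 0 r θ - w‖) ∂τ := by
  refine integral_integral_swap (f := fun (θ : ℝ) (w : ℂ) => Real.log ‖circleMap 0 r θ - w‖) ?_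
  have hmeas : Measurable (fun x : ℝ × ℂ => Real.log ‖circleMap 0 r x.1 - x.2‖) := by
    have := (continuous_circleMap 0 r).measurable
    fun_prop
  refine (integrable_prod_iff hmeas.aestronglyMeasurable).2
    ⟨.of_forall fun θ => hb.1 (circleMap 0 r θ), ?_⟩
  obtain ⟨C, hC⟩ := hb.2 |r|
  refine Integrable.of_bound (C := C)
    hmeas.norm.aestronglyMeasurable.integral_prod_right' (.of_forall fun θ => ?_)
  rw [Real.norm_of_nonneg (integral_nonneg fun _ => norm_nonneg _)]
  exact hC (circleMap 0 r θ) (norm_circleMap_zero r θ).le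

/-- Newton's theorem: by rotation invariance the potential at z equals its mean over the circle of
radius |z|, and exchanging integrals replaces the kernel by its circle mean, log max(|z|, |w|). -/
lemma integral_closedBall_log_eq_log_max (R : ℝ) (z : ℂ) :
    ∫ w in Metric.closedBall 0 R, Real.log ‖z - w‖
      = ∫ w in Metric.closedBall (0 : ℂ) R, Real.log (max ‖z‖ ‖w‖) := by
  rcases eq_or_ne z 0 with rfl | hz
  · simp
  have hz : 0 < ‖z‖ := norm_pos_iff.2 hz
  have hae : ∀ᵐ w : ℂ ∂(volume.restrict (Metric.closedBall 0 R)), w ≠ 0 :=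
    ae_restrict_of_ae (by simp [ae_iff])
  have hswap := (hasBoundedLogPotential_closedBall R).integral_circleMap_swap ‖z‖
  set τ : Measure ℂ := volume.restrict (Metric.closedBall 0 R)
  have e1 : ∀ θ, ∫ w, Real.log ‖circleMap 0 ‖z‖ θ - w‖ ∂τ = ∫ w, Real.log ‖z - w‖ ∂τ := fun θ =>
    integral_closedBall_log_eq_of_norm_eq R (by simp)
  have e2 : ∀ᵐ w ∂τ, ∫ θ in Ioc 0 (2 * Real.pi), Real.log ‖circleMap 0 ‖z‖ θ - w‖
      = 2 * Real.pi * Real.log (max ‖z‖ ‖w‖) := by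
    filter_upwards [hae] with w hw
    rw [← circleAverage_log_norm_sub_eq_log_max hz hw, Real.circleAverage_def,
      intervalIntegral.integral_of_le (by positivity), smul_eq_mul,
      mul_inv_cancel_left₀ (by positivity)]
  rw [integral_congr_ae e2, integral_const_mul] at hswap
  simp only [e1, integral_const, smul_eq_mul, Measure.real, Measure.restrict_apply_univ,
    Real.volume_Ioc, sub_zero, ENNReal.toReal_ofReal Real.two_pi_pos.le] at hswap
  exact mul_left_cancel₀ (by positivity) hswap

lemma integral_closedBall_norm {R : ℝ} (hR : 0 ≤ R) (F : ℝ → ℝ) :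
    ∫ w in Metric.closedBall (0 : ℂ) R, F ‖w‖ = 2 * Real.pi * ∫ y in (0 : ℝ)..R, y * F y := by
  have h := integral_fun_norm_addHaar (volume : Measure ℂ) ((Iic R).indicator F)
  have e : (fun w : ℂ => (Iic R).indicator F ‖w‖)
      = (Metric.closedBall (0 : ℂ) R).indicator (fun w => F ‖w‖) := by
    ext w; simp [indicator]
  rw [e, integral_indicator Metric.isClosed_closedBall.measurableSet] at h
  rw [h, intervalIntegral.integral_of_le hR, ← Ioi_inter_Iic, ← setIntegral_indicator
    measurableSet_Iic]
  simp [Measure.real, indicator, mul_assoc]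

/-- The logarithmic potential of Lebesgue measure on a disk of radius `R` at distance `r`, divided
by `π`. -/
def diskPotential (R r : ℝ) : ℝ :=
  if r ≤ R then R ^ 2 * Real.log R - R ^ 2 / 2 + r ^ 2 / 2 else R ^ 2 * Real.log r

lemma integral_mul_log {a b : ℝ} (ha : 0 ≤ a) (hab : a ≤ b) :
    ∫ y in a..b, y * Real.log y = (b ^ 2 * Real.log b / 2 - b ^ 2 / 4)
      - (a ^ 2 * Real.log a / 2 - a ^ 2 / 4) := by
  refine intervalIntegral.integral_eq_sub_of_hasDerivAt_of_le
    (f := fun y => y ^ 2 * Real.log y / 2 - y ^ 2 / 4) hab ?_ (fun x hx => ?_)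
    (Real.continuous_mul_log.intervalIntegrable _ _)
  · have : (fun y : ℝ => y ^ 2 * Real.log y / 2 - y ^ 2 / 4)
        = fun y => y * (y * Real.log y) / 2 - y ^ 2 / 4 := by ext y; ring
    rw [this]
    have := Real.continuous_mul_log
    fun_prop
  · have hx0 : x ≠ 0 := (ha.trans_lt hx.1).ne'
    refine ((((hasDerivAt_pow 2 x).mul (Real.hasDerivAt_log hx0)).div_const 2).sub
      ((hasDerivAt_pow 2 x).div_const 4)).congr_deriv ?_
    simp
    field_simp
    ring

lemma integral_mul_log_max {R r : ℝ} (hR : 0 ≤ R) (hr : 0 ≤ r) :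
    ∫ y in (0 : ℝ)..R, y * Real.log (max r y) = diskPotential R r / 2 := by
  have h1 : ∀ b, 0 ≤ b → b ≤ r → IntervalIntegrable (fun y => y * Real.log (max r y)) volume 0 b ∧
      ∫ y in (0 : ℝ)..b, y * Real.log (max r y) = b ^ 2 / 2 * Real.log r := fun b hb hbr => by
    have he : EqOn (fun y => y * Real.log (max r y)) (fun y => y * Real.log r) (uIcc 0 b) :=
      fun y hy => by
        rw [uIcc_of_le hb] at hy
        simp only [max_eq_left (hy.2.trans hbr)]
    refine ⟨IntervalIntegrable.congr (he.symm.mono uIoc_subset_uIcc)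
      (by apply Continuous.intervalIntegrable; fun_prop), ?_⟩
    rw [intervalIntegral.integral_congr he, intervalIntegral.integral_mul_const, integral_id]
    ring
  rcases le_or_gt R r with h | h
  · rw [(h1 R hR h).2, diskPotential]
    split_ifs with h'
    · rw [le_antisymm h h']; ring
    · ring
  · have he : EqOn (fun y => y * Real.log (max r y)) (fun y => y * Real.log y) (uIcc r R) :=
      fun y hy => by
        rw [uIcc_of_le h.le] at hy
        simp only [max_eq_right hy.1]
    rw [← intervalIntegral.integral_add_adjacent_intervals (h1 r hr le_rfl).1
      (IntervalIntegrable.congr (he.symm.mono uIoc_subset_uIcc) (Real.continuous_mul_log.intervalIntegrable _ _)),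
      (h1 r hr le_rfl).2, intervalIntegral.integral_congr he, integral_mul_log hr h.le,
      diskPotential, if_pos h.le]
    ring

lemma integral_closedBall_log {R : ℝ} (hR : 0 ≤ R) (z : ℂ) :
    ∫ w in Metric.closedBall 0 R, Real.log ‖z - w‖ = Real.pi * diskPotential R ‖z‖ := by
  rw [integral_closedBall_log_eq_log_max,
    integral_closedBall_norm hR (fun y => Real.log (max ‖z‖ y)),
    integral_mul_log_max hR (norm_nonneg z)]
  ring

end Disk

/-! ### The uniform measure on the circle and its potential. -/

section Circle

instance : IsProbabilityMeasure uniformCircle := by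
  constructor
  rw [uniformCircle, Measure.smul_apply, Measure.map_apply (continuous_circleMap 0 1).measurable
    MeasurableSet.univ, preimage_univ, Measure.restrict_apply_univ, Real.volume_Ioc, sub_zero,
    smul_eq_mul, ← ENNReal.ofReal_mul (by positivity), one_div,
    inv_mul_cancel₀ Real.two_pi_pos.ne', ENNReal.ofReal_one]

instance : NullSingletonClass uniformCircle := by
  constructor
  intro z
  rw [uniformCircle, Measure.smul_apply, Measure.map_apply (continuous_circleMap 0 1).measurable
    (measurableSet_singleton z)]
  have : (circleMap 0 1 ⁻¹' {z}).Countable :=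
    (countable_singleton z).preimage_circleMap 0 one_ne_zero
  simp [this.measure_zero]

lemma ae_uniformCircle_norm : ∀ᵐ z ∂uniformCircle, ‖z‖ = 1 := by
  refine Measure.ae_smul_measure ?_ _
  rw [ae_map_iff (continuous_circleMap 0 1).aemeasurable
    (measurableSet_eq_fun measurable_norm measurable_const)]
  exact .of_forall fun θ => by simp

lemma integrable_uniformCircle {f : ℂ → ℝ} (hf : Measurable f) (hi : CircleIntegrable f 0 1) :
    Integrable f uniformCircle := by
  refine Integrable.smul_measure ?_ ENNReal.ofReal_ne_top
  rw [integrable_map_measure hf.aestronglyMeasurable (continuous_circleMap 0 1).aemeasurable]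
  exact (intervalIntegrable_iff_integrableOn_Ioc_of_le Real.two_pi_pos.le).1 hi

lemma integral_uniformCircle {f : ℂ → ℝ} (hf : Measurable f) :
    ∫ z, f z ∂uniformCircle = Real.circleAverage f 0 1 := by
  rw [uniformCircle, integral_smul_measure, integral_map (continuous_circleMap 0 1).aemeasurable
    hf.aestronglyMeasurable, Real.circleAverage_def,
    intervalIntegral.integral_of_le Real.two_pi_pos.le,
    ENNReal.toReal_ofReal (by positivity), one_div]

lemma integral_uniformCircle_log (z : ℂ) :
    ∫ w, Real.log ‖z - w‖ ∂uniformCircle = Real.posLog ‖z‖ := by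
  simp only [norm_sub_rev z]
  rw [integral_uniformCircle (by fun_prop)]
  exact circleAverage_log_norm_sub_const_eq_posLog

lemma hasBoundedLogPotential_uniformCircle : HasBoundedLogPotential uniformCircle := by
  have hi : ∀ z, Integrable (fun w => Real.log ‖z - w‖) uniformCircle := fun z => by
    simp only [norm_sub_rev z]
    exact integrable_uniformCircle (by fun_prop) (circleIntegrable_log_norm_sub_const 1)
  refine ⟨hi, fun M => ⟨2 * Real.posLog (M + 1), fun z hz => ?_⟩⟩
  -- If x ≤ c and c ≥ 0, then |x| ≤ 2c - x. This reduces the bound on ∫|log| to the explicit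
  -- nonnegative value of ∫ log.
  have h1 : ∀ᵐ w ∂uniformCircle, |Real.log ‖z - w‖| ≤ 2 * Real.posLog (M + 1)
      - Real.log ‖z - w‖ := by
    filter_upwards [ae_uniformCircle_norm] with w hw
    have h2 : Real.log ‖z - w‖ ≤ Real.posLog (M + 1) :=
      (le_max_right _ _).trans (Real.posLog_le_posLog (norm_nonneg _)
        ((norm_sub_le _ _).trans (by linarith)))
    have h3 : 0 ≤ Real.posLog (M + 1) := Real.posLog_nonneg
    rw [abs_le]
    constructor <;> linarith
  refine (integral_mono_ae (hi z).abs ((integrable_const _).sub (hi z)) h1).trans ?_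
  rw [integral_sub' (integrable_const _) (hi z), integral_uniformCircle_log]
  have : 0 ≤ Real.posLog ‖z‖ := Real.posLog_nonneg
  simpa using this

end Circle

/-! ### Support, mass and integrals of the limit measure. -/

section LimitMeasure

variable {α p : ℝ}

lemma setOf_norm_le_eq (R : ℝ) : {z : ℂ | ‖z‖ ≤ R} = Metric.closedBall 0 R := by
  ext z; simp

lemma setOf_annulus_eq (R : ℝ) :
    {z : ℂ | 1 ≤ ‖z‖ ∧ ‖z‖ ≤ R} = Metric.closedBall 0 R \ Metric.ball 0 1 := by
  ext z
  simp [and_comm]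

lemma measurableSet_annulus (R : ℝ) : MeasurableSet {z : ℂ | 1 ≤ ‖z‖ ∧ ‖z‖ ≤ R} := by
  rw [setOf_annulus_eq]
  exact Metric.isClosed_closedBall.measurableSet.diff Metric.isOpen_ball.measurableSet

lemma setIntegral_annulus {f : ℂ → ℝ} {R : ℝ} (hR : 1 ≤ R)
    (hf : IntegrableOn f (Metric.closedBall 0 R)) :
    ∫ z in {z : ℂ | 1 ≤ ‖z‖ ∧ ‖z‖ ≤ R}, f z
      = (∫ z in Metric.closedBall 0 R, f z) - ∫ z in Metric.closedBall 0 1, f z := by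
  -- The annulus omits the open unit disk; the circle is Lebesgue-null, so the closed disk can be
  -- subtracted instead.
  have h : Metric.ball (0 : ℂ) 1 =ᵐ[volume] Metric.closedBall (0 : ℂ) 1 :=
    ae_eq_of_subset_of_measure_ge Metric.ball_subset_closedBall
      (Measure.addHaar_closedBall_eq_addHaar_ball _ _ _).le
      Metric.isOpen_ball.measurableSet.nullMeasurableSet measure_closedBall_lt_top.ne
  rw [setOf_annulus_eq, setIntegral_sdiff Metric.isOpen_ball.measurableSet hf
    (Metric.ball_subset_closedBall.trans (Metric.closedBall_subset_closedBall hR)),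
    setIntegral_congr_set h]

instance isFiniteMeasure_restrict_disk (R : ℝ) :
    IsFiniteMeasure (volume.restrict {z : ℂ | ‖z‖ ≤ R}) := by
  rw [setOf_norm_le_eq]
  exact isFiniteMeasure_restrict.2 measure_closedBall_lt_top.ne

instance isFiniteMeasure_restrict_annulus (R : ℝ) :
    IsFiniteMeasure (volume.restrict {z : ℂ | 1 ≤ ‖z‖ ∧ ‖z‖ ≤ R}) :=
  isFiniteMeasure_restrict.2 ((measure_mono fun z hz => by simpa using hz.2).trans_lt
    (measure_closedBall_lt_top (x := (0 : ℂ)) (r := R))).ne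

instance : IsFiniteMeasure (normLimitMeasure α p) := by
  unfold normLimitMeasure limitMeasure
  have h1 := Measure.smul_finite (volume.restrict {z : ℂ | ‖z‖ ≤ √p} +
    volume.restrict {z : ℂ | 1 ≤ ‖z‖ ∧ ‖z‖ ≤ √α}) (ENNReal.ofReal_ne_top (r := 1 / Real.pi))
  have h2 := Measure.smul_finite uniformCircle (ENNReal.ofReal_ne_top (r := 1 - p))
  exact Measure.smul_finite _ ENNReal.ofReal_ne_top

instance : NullSingletonClass (normLimitMeasure α p) :=
  ⟨fun z => by simp [normLimitMeasure, limitMeasure]⟩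

lemma ae_normLimitMeasure :
    ∀ᵐ z ∂(normLimitMeasure α p), ‖z‖ ≤ √p ∨ 1 ≤ ‖z‖ ∧ (‖z‖ ≤ √α ∨ ‖z‖ = 1) := by
  refine Measure.ae_smul_measure (ae_add_measure_iff.2
    ⟨Measure.ae_smul_measure (ae_add_measure_iff.2 ⟨?_, ?_⟩) _, Measure.ae_smul_measure ?_ _⟩) _
  · rw [setOf_norm_le_eq]
    filter_upwards [ae_restrict_mem Metric.isClosed_closedBall.measurableSet] with z hz
    left
    simpa using hz
  · filter_upwards [ae_restrict_mem (measurableSet_annulus _)] with z hz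
    exact .inr ⟨hz.1, .inl hz.2⟩
  · filter_upwards [ae_uniformCircle_norm] with z hz
    exact .inr ⟨hz.ge, .inr hz⟩

lemma ae_normLimitMeasure_norm_le (hα : 1 ≤ α) (hp1 : p < 1) :
    ∀ᵐ z ∂(normLimitMeasure α p), ‖z‖ ≤ √α := by
  have h1 : 1 ≤ √α := Real.one_le_sqrt.2 hα
  filter_upwards [ae_normLimitMeasure] with z hz
  rcases hz with hz | ⟨-, hz | hz⟩
  · exact hz.trans (Real.sqrt_le_sqrt (hp1.le.trans hα))
  · exact hz
  · exact hz.le.trans h1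

lemma hasBoundedLogPotential_normLimitMeasure : HasBoundedLogPotential (normLimitMeasure α p) := by
  refine .smul (.add (.smul (.add ?_ ?_) ENNReal.ofReal_ne_top)
    (hasBoundedLogPotential_uniformCircle.smul ENNReal.ofReal_ne_top)) ENNReal.ofReal_ne_top
  · rw [setOf_norm_le_eq]
    exact hasBoundedLogPotential_closedBall _
  · refine (hasBoundedLogPotential_closedBall √α).mono (Measure.restrict_mono_set _ fun z hz => ?_)
    simpa using hz.2

lemma integral_normLimitMeasure (hα : 1 ≤ α) (hp1 : p < 1) {f : ℂ → ℝ}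
    (hf : ∀ R, IntegrableOn f (Metric.closedBall 0 R)) (hc : Integrable f uniformCircle) :
    ∫ z, f z ∂(normLimitMeasure α p) = 1 / α * (1 / Real.pi *
      ((∫ z in Metric.closedBall 0 √p, f z) + ((∫ z in Metric.closedBall 0 √α, f z)
        - ∫ z in Metric.closedBall 0 1, f z)) + (1 - p) * ∫ z, f z ∂uniformCircle) := by
  have h1 : Integrable f (volume.restrict {z : ℂ | ‖z‖ ≤ √p}) := by
    rw [setOf_norm_le_eq]; exact hf _
  have h2 : Integrable f (volume.restrict {z : ℂ | 1 ≤ ‖z‖ ∧ ‖z‖ ≤ √α}) :=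
    IntegrableOn.mono_set (hf √α) fun z hz => by simpa using hz.2
  rw [normLimitMeasure, limitMeasure, integral_smul_measure,
    integral_add_measure ((h1.add_measure h2).smul_measure ENNReal.ofReal_ne_top)
      (hc.smul_measure ENNReal.ofReal_ne_top), integral_smul_measure, integral_smul_measure,
    integral_add_measure h1 h2, setIntegral_annulus (Real.one_le_sqrt.2 hα) (hf _),
    setOf_norm_le_eq, ENNReal.toReal_ofReal (by positivity), ENNReal.toReal_ofReal (by positivity),
    ENNReal.toReal_ofReal (by linarith)]
  simp only [smul_eq_mul]

lemma volume_real_closedBall {R : ℝ} (hR : 0 ≤ R) :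
    volume.real (Metric.closedBall (0 : ℂ) R) = Real.pi * R ^ 2 := by
  simp [Measure.real, hR, mul_comm]

lemma isProbabilityMeasure_normLimitMeasure (hα : 1 ≤ α) (hp0 : 0 ≤ p) (hp1 : p < 1) :
    IsProbabilityMeasure (normLimitMeasure α p) := by
  have h := integral_normLimitMeasure (f := fun _ => 1) hα hp1
    (fun R => integrableOn_const measure_closedBall_lt_top.ne) (integrable_const _)
  simp only [integral_const, smul_eq_mul, mul_one, measureReal_restrict_apply_univ, probReal_univ]
    at h
  rw [volume_real_closedBall (by positivity), volume_real_closedBall (by positivity),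
    volume_real_closedBall (by positivity), Real.sq_sqrt hp0, Real.sq_sqrt (by linarith)] at h
  have h' : (normLimitMeasure α p).real univ = 1 := by
    rw [h]
    field_simp
    ring
  constructor
  rw [← ENNReal.toReal_eq_one_iff]
  exact h'

/-- The disk of radius √p alone has mass p/α and lies inside the open unit disk. The lower bound
suffices for comparison with ν. -/
lemma le_normLimitMeasure_ball (hα : 1 ≤ α) (hp0 : 0 ≤ p) (hp1 : p < 1) :
    p / α ≤ (normLimitMeasure α p).real (Metric.ball 0 1) := by
  have hsub : Metric.closedBall (0 : ℂ) √p ⊆ Metric.ball 0 1 :=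
    Metric.closedBall_subset_ball (by rw [Real.sqrt_lt' one_pos]; simpa using hp1)
  have h : ENNReal.ofReal (p / α) ≤ normLimitMeasure α p (Metric.ball 0 1) := by
    simp only [normLimitMeasure, limitMeasure, Measure.smul_apply, Measure.add_apply, smul_eq_mul]
    calc ENNReal.ofReal (p / α)
        = ENNReal.ofReal (1 / α) * (ENNReal.ofReal (1 / Real.pi) *
          volume (Metric.closedBall (0 : ℂ) √p)) := by
          rw [← ofReal_measureReal measure_closedBall_lt_top.ne,
            volume_real_closedBall (by positivity), Real.sq_sqrt hp0,
            ← ENNReal.ofReal_mul (by positivity), ← ENNReal.ofReal_mul (by positivity)]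
          congr 1
          field_simp
      _ = ENNReal.ofReal (1 / α) * (ENNReal.ofReal (1 / Real.pi) *
          volume.restrict {z : ℂ | ‖z‖ ≤ √p} (Metric.ball 0 1)) := by
          rw [setOf_norm_le_eq, Measure.restrict_apply Metric.isOpen_ball.measurableSet,
            inter_eq_right.2 hsub]
      _ ≤ _ := by
          gcongr
          exact le_add_right (by gcongr; exact le_self_add)
  rw [Measure.real, ← ENNReal.ofReal_le_iff_le_toReal (measure_ne_top _ _)]
  exact h

end LimitMeasure

/-! ### The effective potential and its variational inequality. -/

section Potential

variable {α p : ℝ}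

/-- The logarithmic potential of the limit measure. -/
def limitPotential (α p : ℝ) (z : ℂ) : ℝ := ∫ w, Real.log ‖z - w‖ ∂(normLimitMeasure α p)

lemma mul_limitPotential_eq (hα : 1 ≤ α) (hp1 : p < 1) (z : ℂ) :
    α * limitPotential α p z = diskPotential √p ‖z‖ + (diskPotential √α ‖z‖ - diskPotential 1 ‖z‖)
      + (1 - p) * Real.posLog ‖z‖ := by
  rw [limitPotential, integral_normLimitMeasure hα hp1
    (fun R => (hasBoundedLogPotential_closedBall R).1 z)
    (hasBoundedLogPotential_uniformCircle.1 z), integral_closedBall_log (by positivity),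
    integral_closedBall_log (by positivity), integral_closedBall_log (by positivity),
    integral_uniformCircle_log]
  field_simp

lemma diskPotential_sqrt {q r : ℝ} (hq : 0 ≤ q) :
    diskPotential √q r = if r ≤ √q then q * Real.log q / 2 - q / 2 + r ^ 2 / 2
      else q * Real.log r := by
  simp only [diskPotential, Real.sq_sqrt hq, Real.log_sqrt hq]
  congr 1
  ring

/-- The minimum of r² - 2q log r is at r = √q; use log x ≤ x - 1 at x = r²/q. It serves the
forbidden annulus (q = p), the exterior (q = α) and the sign of the gap (q = p, r = 1). -/
lemma sub_mul_log_le {q r : ℝ} (hq : 0 ≤ q) (hr : 0 < r) :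
    q - q * Real.log q ≤ r ^ 2 - 2 * q * Real.log r := by
  rcases hq.eq_or_lt with rfl | hq
  · simp; positivity
  have h := Real.log_le_sub_one_of_pos (show 0 < r ^ 2 / q by positivity)
  rw [Real.log_div (by positivity) hq.ne', Real.log_pow] at h
  have h2 := mul_le_mul_of_nonneg_left h hq.le
  have h3 : q * (r ^ 2 / q - 1) = r ^ 2 - q := by field_simp
  rw [h3] at h2
  push_cast at h2
  linarith

lemma potentialGap_nonneg (hp0 : 0 ≤ p) : 0 ≤ 1 - p + p * Real.log p := by
  have := sub_mul_log_le hp0 one_pos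
  simp at this
  linarith

lemma limitPotential_of_le_sqrt (hα : 1 ≤ α) (hp0 : 0 ≤ p) (hp1 : p < 1) {z : ℂ}
    (hz : ‖z‖ ≤ √p) : ‖z‖ ^ 2 - 2 * (α * limitPotential α p z)
      = α - α * Real.log α - (1 - p + p * Real.log p) := by
  have h1 : √p ≤ 1 := Real.sqrt_le_one.2 hp1.le
  have h2 : 1 ≤ √α := Real.one_le_sqrt.2 hα
  rw [mul_limitPotential_eq hα hp1, diskPotential_sqrt hp0, diskPotential_sqrt (by linarith),
    if_pos hz, if_pos (by linarith), diskPotential, if_pos (by linarith),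
    (Real.posLog_eq_zero_iff _).2 (by rw [abs_norm]; linarith)]
  simp
  ring

lemma limitPotential_of_sqrt_lt_of_lt_one (hα : 1 ≤ α) (hp0 : 0 ≤ p) (hp1 : p < 1) {z : ℂ}
    (hz : √p < ‖z‖) (hz1 : ‖z‖ ≤ 1) :
    α - α * Real.log α - (1 - p + p * Real.log p) ≤
      ‖z‖ ^ 2 - 2 * (α * limitPotential α p z) := by
  have h2 : 1 ≤ √α := Real.one_le_sqrt.2 hα
  rw [mul_limitPotential_eq hα hp1, diskPotential_sqrt hp0, diskPotential_sqrt (by linarith),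
    if_neg hz.not_ge, if_pos (by linarith), diskPotential, if_pos (by linarith),
    (Real.posLog_eq_zero_iff _).2 (by rwa [abs_norm])]
  have := sub_mul_log_le hp0 ((Real.sqrt_nonneg p).trans_lt hz)
  simp
  linarith

/-- Seen from |z| ≥ 1, the inner disk and the circle carry p + (1 - p) = 1, the mass removed with
the unit disk, so U is that of the full disk of radius √α. -/
lemma limitPotential_of_one_le (hα : 1 ≤ α) (hp0 : 0 ≤ p) (hp1 : p < 1) {z : ℂ}
    (hz : 1 ≤ ‖z‖) : ‖z‖ ^ 2 - 2 * (α * limitPotential α p z)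
      = if ‖z‖ ≤ √α then α - α * Real.log α else ‖z‖ ^ 2 - 2 * α * Real.log ‖z‖ := by
  have h1 : √p < 1 := by rw [Real.sqrt_lt' one_pos]; simpa using hp1
  have h3 : diskPotential 1 ‖z‖ = Real.log ‖z‖ := by
    rw [diskPotential]
    split_ifs with h
    · rw [le_antisymm h hz]; simp
    · simp
  rw [mul_limitPotential_eq hα hp1, diskPotential_sqrt hp0, diskPotential_sqrt (by linarith),
    if_neg (by linarith), h3, Real.posLog_eq_log (by rwa [abs_norm])]
  split_ifs <;> ring

/-- The obstacle condition: 1 - p + p log p is the Lagrange multiplier of the constraint on the unit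
disk. -/
lemma le_limitPotential (hα : 1 ≤ α) (hp0 : 0 ≤ p) (hp1 : p < 1) (z : ℂ) :
    α - α * Real.log α - (1 - p + p * Real.log p) *
      (Metric.ball (0 : ℂ) 1).indicator 1 z ≤ ‖z‖ ^ 2 - 2 * (α * limitPotential α p z) := by
  rcases lt_or_ge ‖z‖ 1 with hz | hz
  · rw [indicator_of_mem (by simpa using hz), Pi.one_apply, mul_one]
    rcases le_or_gt ‖z‖ √p with h | h
    · exact (limitPotential_of_le_sqrt hα hp0 hp1 h).ge
    · exact limitPotential_of_sqrt_lt_of_lt_one hα hp0 hp1 h hz.le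
  · rw [indicator_of_notMem (by simpa using hz), mul_zero, sub_zero,
      limitPotential_of_one_le hα hp0 hp1 hz]
    split_ifs
    · exact le_rfl
    · exact sub_mul_log_le (by linarith) (by linarith)

lemma limitPotential_ae_eq (hα : 1 ≤ α) (hp0 : 0 ≤ p) (hp1 : p < 1) :
    ∀ᵐ z ∂(normLimitMeasure α p), ‖z‖ ^ 2 - 2 * (α * limitPotential α p z)
      = α - α * Real.log α - (1 - p + p * Real.log p) *
      (Metric.ball (0 : ℂ) 1).indicator 1 z := by
  have h1 : √p < 1 := by rw [Real.sqrt_lt' one_pos]; simpa using hp1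
  have h2 : 1 ≤ √α := Real.one_le_sqrt.2 hα
  filter_upwards [ae_normLimitMeasure] with z hz
  rcases hz with hz | ⟨hz, h⟩
  · rw [limitPotential_of_le_sqrt hα hp0 hp1 hz,
      indicator_of_mem (by simpa using hz.trans_lt h1)]
    simp
  · rw [limitPotential_of_one_le hα hp0 hp1 hz, if_pos (h.elim id fun h => h.le.trans h2),
      indicator_of_notMem (by simpa using hz)]
    simp

/-- The Euler–Lagrange inequality: the limit measure minimizes the integral of its effective
potential among measures with the prescribed deficiency on the unit disk. -/
lemma integral_effectivePotential_le (hα : 1 ≤ α) (hp0 : 0 ≤ p) (hp1 : p < 1) {ν : Measure ℂ}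
    [IsProbabilityMeasure ν] {M : ℝ} (hM : ∀ᵐ z ∂ν, ‖z‖ ≤ M)
    (hν : ν.real (Metric.ball 0 1) ≤ p / α) :
    ∫ z, (‖z‖ ^ 2 - 2 * (α * limitPotential α p z)) ∂(normLimitMeasure α p)
      ≤ ∫ z, (‖z‖ ^ 2 - 2 * (α * limitPotential α p z)) ∂ν := by
  have := isProbabilityMeasure_normLimitMeasure hα hp0 hp1
  have hgap := potentialGap_nonneg hp0
  have hi : ∀ ρ : Measure ℂ, IsProbabilityMeasure ρ →
      Integrable (fun z : ℂ => α - α * Real.log α - (1 - p + p * Real.log p) *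
      (Metric.ball (0 : ℂ) 1).indicator 1 z) ρ ∧
      ∫ z : ℂ, (α - α * Real.log α - (1 - p + p * Real.log p) *
      (Metric.ball (0 : ℂ) 1).indicator 1 z) ∂ρ = α - α * Real.log α -
        (1 - p + p * Real.log p) * ρ.real (Metric.ball 0 1) := fun ρ _ => by
    have h1 : Integrable ((Metric.ball (0 : ℂ) 1).indicator (1 : ℂ → ℝ)) ρ :=
      (integrable_const (1 : ℝ)).indicator Metric.isOpen_ball.measurableSet
    refine ⟨(integrable_const _).sub (h1.const_mul _), ?_⟩
    rw [integral_sub (integrable_const _) (h1.const_mul _), integral_const_mul,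
      integral_indicator_one Metric.isOpen_ball.measurableSet]
    simp
  have hsq : Integrable (fun z : ℂ => ‖z‖ ^ 2) ν := by
    refine Integrable.of_bound (C := M ^ 2) (by fun_prop) ?_
    filter_upwards [hM] with z hz
    rw [Real.norm_of_nonneg (by positivity)]
    gcongr
  have hU : Integrable (limitPotential α p) ν :=
    (hasBoundedLogPotential_normLimitMeasure.integrable_prod hM).integral_prod_left
  rw [integral_congr_ae (limitPotential_ae_eq hα hp0 hp1), (hi _ inferInstance).2]
  refine le_trans ?_ (integral_mono (hi ν inferInstance).1
    (hsq.sub ((hU.const_mul α).const_mul 2)) (le_limitPotential hα hp0 hp1))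
  rw [(hi ν inferInstance).2]
  -- The constraint on ν enters here: a nonnegative gap multiplies ν(disk) ≤ p/α ≤ μ(disk).
  have := mul_le_mul_of_nonneg_left (hν.trans (le_normLimitMeasure_ball hα hp0 hp1)) hgap
  linarith

end Potential

/-! ### Cauchy–Schwarz inequality for the logarithmic energy. -/

section Quadratic

/-- The mutual logarithmic energy of two measures, as a real integral. -/
def mutualEnergy (ρ τ : Measure ℂ) : ℝ := ∫ q : ℂ × ℂ, Real.log ‖q.1 - q.2‖ ∂(ρ.prod τ)

lemma integral_log_prod_swap (ρ τ : Measure ℂ) [SFinite ρ] [SFinite τ] (f g : ℂ → ℝ) :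
    ∫ q : ℂ × ℂ, f q.1 * g q.2 * Real.log ‖q.1 - q.2‖ ∂(ρ.prod τ)
      = ∫ q : ℂ × ℂ, g q.1 * f q.2 * Real.log ‖q.1 - q.2‖ ∂(τ.prod ρ) := by
  rw [← integral_prod_swap]
  refine integral_congr_ae (.of_forall fun q => ?_)
  simp only [Prod.fst_swap, Prod.snd_swap, norm_sub_rev q.1]
  ring

lemma mutualEnergy_comm (ρ τ : Measure ℂ) [SFinite ρ] [SFinite τ] :
    mutualEnergy ρ τ = mutualEnergy τ ρ := by
  simpa [mutualEnergy] using integral_log_prod_swap ρ τ (fun _ => 1) (fun _ => 1)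

variable {φ : ℂ → ℝ} {R : ℝ}

lemma support_lap_integral (hR : tsupport (lap φ) ⊆ Metric.closedBall 0 R) (F : ℂ → ℝ) :
    ∫ w in Metric.closedBall 0 R, F w * lap φ w = ∫ w, F w * lap φ w := by
  refine setIntegral_eq_integral_of_forall_compl_eq_zero fun w hw => ?_
  rw [image_eq_zero_of_notMem_tsupport fun h => hw (hR h), mul_zero]

/-- The weight f lets one formula cover both the interaction of Δφ with ν or μ (f = 1) and its
self-interaction (f = Δφ). -/
lemma integral_prod_log_mul_lap (hφ : ContDiff ℝ 2 φ) (hc : HasCompactSupport φ)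
    (hR : tsupport (lap φ) ⊆ Metric.closedBall 0 R) {ρ : Measure ℂ} [IsFiniteMeasure ρ]
    {M C : ℝ} (hM : ∀ᵐ z ∂ρ, ‖z‖ ≤ M) {f : ℂ → ℝ} (hf : Measurable f) (hC : ∀ z, |f z| ≤ C) :
    ∫ q : ℂ × ℂ, f q.1 * lap φ q.2 * Real.log ‖q.1 - q.2‖
      ∂(ρ.prod (volume.restrict (Metric.closedBall 0 R)))
      = 2 * Real.pi * ∫ z, f z * φ z ∂ρ := by
  obtain ⟨D, hD⟩ := (lap_continuous hφ).bounded_above_of_compact_support (lap_hasCompactSupport hc)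
  have hlm := (lap_continuous hφ).measurable
  have hi : Integrable (fun q : ℂ × ℂ => f q.1 * lap φ q.2 * Real.log ‖q.1 - q.2‖)
      (ρ.prod (volume.restrict (Metric.closedBall 0 R))) := by
    refine ((hasBoundedLogPotential_closedBall R).integrable_prod hM).bdd_mul (c := C * D)
      (by fun_prop) (.of_forall fun q => ?_)
    rw [norm_mul]
    have : 0 ≤ C := (abs_nonneg _).trans (hC 0)
    gcongr
    · exact hC _
    · exact hD _
  rw [integral_prod _ hi, ← integral_const_mul]
  refine integral_congr_ae (.of_forall fun z => ?_)
  simp only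
  have e : ∀ w, f z * lap φ w * Real.log ‖z - w‖ = f z * (Real.log ‖z - w‖ * lap φ w) :=
    fun w => by ring
  simp only [e]
  rw [integral_const_mul, support_lap_integral hR, integral_log_norm_sub_mul_lap hφ hc]
  ring

lemma dirichletEnergy_nonneg (φ : ℂ → ℝ) : 0 ≤ dirichletEnergy φ :=
  integral_nonneg fun _ => by positivity

/-- The left side is the logarithmic energy of the neutral charge ν - μ + tΔφ dm. Green's
representation gives the cross terms, and ∫φΔφ = -𝔇(φ) the term in t². -/
lemma quadratic_le_zero (hφ : ContDiff ℝ 2 φ) (hc : HasCompactSupport φ)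
    {ν μ : Measure ℂ} [IsProbabilityMeasure ν] [IsProbabilityMeasure μ] [NullSingletonClass μ]
    {M : ℝ} (hMν : ∀ᵐ z ∂ν, ‖z‖ ≤ M) (hMμ : ∀ᵐ z ∂μ, ‖z‖ ≤ M) (hμ : HasBoundedLogPotential μ)
    (hne : ∀ᵐ q : ℂ × ℂ ∂(ν.prod ν), q.1 ≠ q.2)
    (hlog : Integrable (fun q : ℂ × ℂ => Real.log ‖q.1 - q.2‖) (ν.prod ν)) (t : ℝ) :
    mutualEnergy ν ν + mutualEnergy μ μ - 2 * mutualEnergy ν μ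
      + 2 * t * (2 * Real.pi * (∫ z, φ z ∂ν - ∫ z, φ z ∂μ))
      - 2 * Real.pi * dirichletEnergy φ * t ^ 2 ≤ 0 := by
  obtain ⟨R, hR⟩ := (lap_hasCompactSupport hc).isCompact.isBounded.subset_closedBall (0 : ℂ)
  set σ : Measure ℂ := volume.restrict (Metric.closedBall 0 R) with hσ
  have : IsFiniteMeasure σ := isFiniteMeasure_restrict.2 measure_closedBall_lt_top.ne
  have : NullSingletonClass σ := by rw [hσ]; infer_instance
  have hbσ : HasBoundedLogPotential σ := hasBoundedLogPotential_closedBall R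
  have hMσ : ∀ᵐ z ∂σ, ‖z‖ ≤ R := by
    filter_upwards [ae_restrict_mem Metric.isClosed_closedBall.measurableSet] with z hz
    simpa using hz
  obtain ⟨D, hD⟩ := (lap_continuous hφ).bounded_above_of_compact_support (lap_hasCompactSupport hc)
  have hD0 : 0 ≤ D := (norm_nonneg _).trans (hD 0)
  have hlm := (lap_continuous hφ).measurable
  have hlap0 : ∫ z, lap φ z ∂σ = 0 := by
    have := support_lap_integral hR (fun _ => 1)
    simp only [one_mul, integral_lap hφ hc] at this
    exact this
  -- The signed charge is encoded by three positive measures with weights 1, -1 and tΔφ.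
  let τ : Fin 3 → Measure ℂ := ![ν, μ, σ]
  have : ∀ i, IsFiniteMeasure (τ i) := fun i => by
    fin_cases i <;> simp only [τ] <;> dsimp <;> infer_instance
  have key := sum_integral_log_nonpos τ ![fun _ => 1, fun _ => -1, fun z => t * lap φ z]
    (C := 1 + |t| * D) ?_ ?_ ?_ ?_ ?_
  · have X := fun (ρ : Measure ℂ) (_ : IsProbabilityMeasure ρ) (hM : ∀ᵐ z ∂ρ, ‖z‖ ≤ M) =>
      integral_prod_log_mul_lap hφ hc hR hM (f := fun _ => 1) measurable_const (C := 1) (by simp)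
    have Y := integral_prod_log_mul_lap hφ hc hR hMσ (f := lap φ) hlm (C := D) hD
    have Y' : ∫ z, lap φ z * φ z ∂σ = - dirichletEnergy φ := by
      simp only [mul_comm (lap φ _)]
      rw [hσ, support_lap_integral hR, integral_mul_lap hφ hc]
    rw [Y'] at Y
    have X1 := X ν inferInstance hMν
    have X2 := X μ inferInstance hMμ
    have X1' := integral_log_prod_swap ν σ (fun _ => 1) (lap φ)
    have X2' := integral_log_prod_swap μ σ (fun _ => 1) (lap φ)
    have Z := mutualEnergy_comm μ ν
    rw [X1] at X1'
    rw [X2] at X2'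
    simp only [one_mul, mul_one] at X1 X2 X1' X2'
    have n1 : ∀ (ρ : Measure (ℂ × ℂ)) (f : ℂ × ℂ → ℝ), ∫ q, t * f q * Real.log ‖q.1 - q.2‖ ∂ρ
        = t * ∫ q, f q * Real.log ‖q.1 - q.2‖ ∂ρ := fun ρ f => by
      simp only [mul_assoc]; exact integral_const_mul _ _
    have n2 : ∫ q : ℂ × ℂ, t * lap φ q.1 * (t * lap φ q.2) * Real.log ‖q.1 - q.2‖ ∂(σ.prod σ)
        = t ^ 2 * ∫ q : ℂ × ℂ, lap φ q.1 * lap φ q.2 * Real.log ‖q.1 - q.2‖ ∂(σ.prod σ) := by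
      rw [← integral_const_mul]
      refine integral_congr_ae (.of_forall fun q => ?_)
      simp only
      ring
    simp only [Fin.sum_univ_three, τ, Matrix.cons_val_zero, Matrix.cons_val_one,
      Matrix.cons_val] at key
    simp only [one_mul, mul_one, neg_mul, mul_neg, neg_neg, integral_neg] at key
    rw [n2, n1 _ (fun q => lap φ q.2), n1 _ (fun q => lap φ q.2), n1 _ (fun q => lap φ q.1),
      n1 _ (fun q => lap φ q.1), X1, X2, ← X1', ← X2', Y] at key
    simp only [mutualEnergy] at Z ⊢
    rw [Z] at key
    linarith
  · intro i
    fin_cases i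
    · exact measurable_const
    · exact measurable_const
    · exact hlm.const_mul t
  · intro i z
    have h0 : 0 ≤ |t| * D := by positivity
    fin_cases i
    · simpa using h0
    · simpa using h0
    · have : |t * lap φ z| ≤ |t| * D := by
        rw [abs_mul]; exact mul_le_mul_of_nonneg_left (hD z) (abs_nonneg t)
      exact this.trans (by linarith)
  · intro i j
    fin_cases i <;> fin_cases j
    · exact hne
    · exact ae_fst_ne_snd ν μ
    · exact ae_fst_ne_snd ν σ
    · exact ae_fst_ne_snd' ν μ
    · exact ae_fst_ne_snd μ μ
    · exact ae_fst_ne_snd μ σ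
    · exact ae_fst_ne_snd' ν σ
    · exact ae_fst_ne_snd' μ σ
    · exact ae_fst_ne_snd σ σ
  · intro i j
    fin_cases i <;> fin_cases j
    · exact hlog
    · exact hμ.integrable_prod hMν
    · exact hbσ.integrable_prod hMν
    · exact hμ.integrable_prod_swap hMν
    · exact hμ.integrable_prod hMμ
    · exact hbσ.integrable_prod hMμ
    · exact hbσ.integrable_prod_swap hMν
    · exact hbσ.integrable_prod_swap hMμ
    · exact hbσ.integrable_prod hMσ
  · simp [Fin.sum_univ_three, τ, integral_const_mul, hlap0]

/-- Cauchy–Schwarz for the logarithmic energy, against a test function. -/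
lemma energy_sub_ge (hφ : ContDiff ℝ 2 φ) (hc : HasCompactSupport φ)
    {ν μ : Measure ℂ} [IsProbabilityMeasure ν] [IsProbabilityMeasure μ] [NullSingletonClass μ]
    {M : ℝ} (hMν : ∀ᵐ z ∂ν, ‖z‖ ≤ M) (hMμ : ∀ᵐ z ∂μ, ‖z‖ ≤ M) (hμ : HasBoundedLogPotential μ)
    (hne : ∀ᵐ q : ℂ × ℂ ∂(ν.prod ν), q.1 ≠ q.2)
    (hlog : Integrable (fun q : ℂ × ℂ => Real.log ‖q.1 - q.2‖) (ν.prod ν)) :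
    2 * Real.pi / dirichletEnergy φ * (∫ z, φ z ∂ν - ∫ z, φ z ∂μ) ^ 2
      ≤ 2 * mutualEnergy ν μ - mutualEnergy ν ν - mutualEnergy μ μ := by
  have Q := quadratic_le_zero hφ hc hMν hMμ hμ hne hlog
  rcases (dirichletEnergy_nonneg φ).eq_or_lt with h | h
  -- When 𝔇(φ) = 0 the quotient is 0 by convention, and plain negativity (t = 0) is enough.
  · have := Q 0
    rw [← h]
    simp at this ⊢
    linarith
  -- This t maximizes the quadratic polynomial.
  · have := Q ((∫ z, φ z ∂ν - ∫ z, φ z ∂μ) / dirichletEnergy φ)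
    have e : 2 * ((∫ z, φ z ∂ν - ∫ z, φ z ∂μ) / dirichletEnergy φ) *
        (2 * Real.pi * (∫ z, φ z ∂ν - ∫ z, φ z ∂μ)) - 2 * Real.pi * dirichletEnergy φ *
        ((∫ z, φ z ∂ν - ∫ z, φ z ∂μ) / dirichletEnergy φ) ^ 2
        = 2 * Real.pi / dirichletEnergy φ * (∫ z, φ z ∂ν - ∫ z, φ z ∂μ) ^ 2 := by
      field_simp
      ring
    linarith

end Quadratic

/-! ### From extended-valued energies to real integrals. -/

section Extended

lemma extIntegral_eq_coe {X : Type*} [MeasurableSpace X] {μ : Measure X} {f : X → EReal}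
    {g : X → ℝ} (hg : Integrable g μ) (h : ∀ᵐ x ∂μ, f x = g x) :
    extIntegral μ f = ((∫ x, g x ∂μ : ℝ) : EReal) := by
  have h1 : ∫⁻ x, (f x).toENNReal ∂μ = ∫⁻ x, ENNReal.ofReal (g x) ∂μ := by
    refine lintegral_congr_ae ?_
    filter_upwards [h] with x hx
    rw [hx, EReal.toENNReal_of_ne_top (EReal.coe_ne_top _), EReal.toReal_coe]
  have h2 : ∫⁻ x, (-f x).toENNReal ∂μ = ∫⁻ x, ENNReal.ofReal (-g x) ∂μ := by
    refine lintegral_congr_ae ?_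
    filter_upwards [h] with x hx
    rw [hx, ← EReal.coe_neg, EReal.toENNReal_of_ne_top (EReal.coe_ne_top _), EReal.toReal_coe]
  have f1 : ∫⁻ x, ENNReal.ofReal (g x) ∂μ ≠ ⊤ := hg.lintegral_lt_top.ne
  have f2 : ∫⁻ x, ENNReal.ofReal (-g x) ∂μ ≠ ⊤ := hg.neg.lintegral_lt_top.ne
  rw [extIntegral, h1, h2, integral_eq_lintegral_pos_part_sub_lintegral_neg_part hg,
    EReal.coe_sub, EReal.coe_ennreal_toReal f1, EReal.coe_ennreal_toReal f2]

lemma log_enorm_of_ne_zero {x : ℂ} (hx : x ≠ 0) :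
    ENNReal.log ‖x‖ₑ = ((Real.log ‖x‖ : ℝ) : EReal) := by
  rw [← ofReal_norm, ENNReal.log_ofReal_of_pos (norm_pos_iff.2 hx)]

lemma logEnergy_eq_coe {ν : Measure ℂ} (hne : ∀ᵐ q : ℂ × ℂ ∂(ν.prod ν), q.1 ≠ q.2)
    (hlog : Integrable (fun q : ℂ × ℂ => Real.log ‖q.1 - q.2‖) (ν.prod ν)) :
    logEnergy ν = (mutualEnergy ν ν : EReal) := by
  refine extIntegral_eq_coe hlog ?_
  filter_upwards [hne] with q hq
  exact log_enorm_of_ne_zero (sub_ne_zero.2 hq)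

/-- A compactly supported measure has either infinite energy or an integrable kernel. -/
lemma logEnergy_eq_bot_or {ν : Measure ℂ} [IsFiniteMeasure ν] {M : ℝ}
    (hM : ∀ᵐ z ∂ν, ‖z‖ ≤ M) :
    logEnergy ν = ⊥ ∨ (∀ᵐ q : ℂ × ℂ ∂(ν.prod ν), q.1 ≠ q.2) ∧
      Integrable (fun q : ℂ × ℂ => Real.log ‖q.1 - q.2‖) (ν.prod ν) := by
  set f : ℂ × ℂ → EReal := fun q => ENNReal.log ‖q.1 - q.2‖ₑ with hf
  have hfm : Measurable f := ENNReal.measurable_log.comp (by fun_prop)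
  have hb : ∀ᵐ q : ℂ × ℂ ∂(ν.prod ν), ‖q.1 - q.2‖ ≤ 2 * M := by
    filter_upwards [Measure.quasiMeasurePreserving_fst.ae hM,
      Measure.quasiMeasurePreserving_snd.ae hM] with q h1 h2
    exact (norm_sub_le _ _).trans (by linarith)
  have hlogb : ∀ᵐ q : ℂ × ℂ ∂(ν.prod ν), Real.log ‖q.1 - q.2‖ ≤ Real.posLog (2 * M) := by
    filter_upwards [hb] with q hq
    exact (le_max_right _ _).trans (Real.posLog_le_posLog (norm_nonneg _) hq)
  -- On a bounded support the kernel is bounded above, so only the negative part can diverge.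
  have hpos : ∫⁻ q, (f q).toENNReal ∂(ν.prod ν) ≠ ⊤ := by
    refine ne_top_of_le_ne_top ?_ (lintegral_mono_ae (g := fun _ =>
      ENNReal.ofReal (Real.posLog (2 * M))) ?_)
    · rw [lintegral_const]
      exact ENNReal.mul_ne_top ENNReal.ofReal_ne_top (measure_ne_top _ _)
    · filter_upwards [hlogb] with q hq
      rcases eq_or_ne q.1 q.2 with h | h
      · simp [hf, h]
      · rw [hf]
        simp only
        rw [log_enorm_of_ne_zero (sub_ne_zero.2 h), EReal.toENNReal_of_ne_top (EReal.coe_ne_top _),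
          EReal.toReal_coe]
        exact ENNReal.ofReal_le_ofReal hq
  by_cases hneg : ∫⁻ q, (-f q).toENNReal ∂(ν.prod ν) = ⊤
  · left
    rw [logEnergy, extIntegral, hneg, EReal.coe_ennreal_top]
    exact EReal.sub_top _
  · right
    -- On the diagonal -log 0 = ⊤, so a finite negative part forces the diagonal to be null.
    have hne : ∀ᵐ q : ℂ × ℂ ∂(ν.prod ν), q.1 ≠ q.2 := by
      filter_upwards [ae_lt_top (by fun_prop) hneg] with q hq h
      simp [hf, h] at hq
    refine ⟨hne, measurable_log_norm_sub.aestronglyMeasurable, ?_⟩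
    have hle : ∀ᵐ q : ℂ × ℂ ∂(ν.prod ν), ‖Real.log ‖q.1 - q.2‖‖ₑ
        ≤ (f q).toENNReal + (-f q).toENNReal := by
      filter_upwards [hne] with q hq
      simp only [hf]
      rw [log_enorm_of_ne_zero (sub_ne_zero.2 hq), ← EReal.coe_neg,
        EReal.toENNReal_of_ne_top (EReal.coe_ne_top _), EReal.toReal_coe,
        EReal.toENNReal_of_ne_top (EReal.coe_ne_top _), EReal.toReal_coe, Real.enorm_eq_ofReal_abs]
      rcases le_total 0 (Real.log ‖q.1 - q.2‖) with h | h
      · rw [abs_of_nonneg h]; exact le_self_add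
      · rw [abs_of_nonpos h]; exact le_add_self
    refine (lintegral_mono_ae hle).trans_lt ?_
    rw [lintegral_add_left hfm.ereal_toENNReal]
    exact ENNReal.add_lt_top.2 ⟨hpos.lt_top, Ne.lt_top hneg⟩

lemma integrable_norm_sq_div {ν : Measure ℂ} [IsFiniteMeasure ν] {M : ℝ}
    (hM : ∀ᵐ z ∂ν, ‖z‖ ≤ M) (α : ℝ) : Integrable (fun z : ℂ => ‖z‖ ^ 2 / α) ν := by
  refine Integrable.div_const (Integrable.of_bound (C := M ^ 2) (by fun_prop) ?_) α
  filter_upwards [hM] with z hz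
  rw [Real.norm_of_nonneg (by positivity)]
  gcongr

lemma lintegral_norm_sq_div {ν : Measure ℂ} [IsFiniteMeasure ν] {M : ℝ}
    (hM : ∀ᵐ z ∂ν, ‖z‖ ≤ M) {α : ℝ} (hα : 0 ≤ α) :
    ((∫⁻ z, ENNReal.ofReal (‖z‖ ^ 2 / α) ∂ν : ENNReal) : EReal)
      = ((∫ z, ‖z‖ ^ 2 / α ∂ν : ℝ) : EReal) := by
  rw [← ofReal_integral_eq_lintegral_ofReal (integrable_norm_sq_div hM α)
    (.of_forall fun z => by positivity), EReal.coe_ennreal_ofReal,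
    max_eq_left (integral_nonneg fun z => by positivity)]

end Extended

/-! ### Assembly of the two bounds. -/

lemma exists_ae_norm_le_of_isCompact_support {ν : Measure ℂ} (h : IsCompact ν.support) :
    ∃ M, ∀ᵐ z ∂ν, ‖z‖ ≤ M := by
  obtain ⟨M, hM⟩ := h.isBounded.exists_norm_le
  exact ⟨M, Filter.mem_of_superset Measure.support_mem_ae fun z hz => hM z hz⟩

lemma mutualEnergy_normLimitMeasure {α p : ℝ} {ν : Measure ℂ} [IsFiniteMeasure ν] {M : ℝ}
    (hM : ∀ᵐ z ∂ν, ‖z‖ ≤ M) : Integrable (limitPotential α p) ν ∧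
    mutualEnergy ν (normLimitMeasure α p) = ∫ z, limitPotential α p z ∂ν := by
  have hi := (hasBoundedLogPotential_normLimitMeasure (α := α) (p := p)).integrable_prod hM
  exact ⟨hi.integral_prod_left, integral_prod _ hi⟩

end CoulombGas

end

theorem mainTheorem7 (α : ℝ) (hα : 1 ≤ α) (p : ℝ) (hp0 : 0 ≤ p) (hp1 : p < 1)
    (φ : ℂ → ℝ) (hφ : ContDiff ℝ 2 φ) (hφc : HasCompactSupport φ)
    (lam : ℝ) (hlam : 0 < lam)
    (ν : ProbabilityMeasure ℂ) (hνc : IsCompact (ν : Measure ℂ).support)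
    (hν : ν ∈ CoulombGas.deficientMeasures α p ∩ CoulombGas.farMeasures α p φ lam) :
    CoulombGas.energyFunctional α (ν : Measure ℂ) ≥
      CoulombGas.energyFunctional α (CoulombGas.normLimitMeasure α p) +
        ((2 * Real.pi / CoulombGas.dirichletEnergy φ * lam ^ 2 : ℝ) : EReal) := by
  open CoulombGas in
  obtain ⟨hdef, hfar⟩ := hν
  have hα0 : 0 < α := by linarith
  have := isProbabilityMeasure_normLimitMeasure hα hp0 hp1
  obtain ⟨M₁, hM₁⟩ := exists_ae_norm_le_of_isCompact_support hνc
  have hM₂ := ae_normLimitMeasure_norm_le hα hp1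
  rw [energyFunctional, lintegral_norm_sq_div hM₁ hα0.le]
  -- If the logarithmic energy is -∞, the left side is +∞; otherwise everything is real.
  rcases logEnergy_eq_bot_or hM₁ with hbot | ⟨hne, hlog⟩
  · rw [hbot, EReal.coe_sub_bot]
    exact le_top
  have hb := hasBoundedLogPotential_normLimitMeasure (α := α) (p := p)
  rw [logEnergy_eq_coe hne hlog, energyFunctional, lintegral_norm_sq_div hM₂ hα0.le,
    logEnergy_eq_coe (ae_fst_ne_snd _ _) (hb.integrable_prod hM₂), ← EReal.coe_sub,
    ← EReal.coe_sub, ← EReal.coe_add, ge_iff_le, EReal.coe_le_coe_iff]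
  have hball : (ν : Measure ℂ).real (Metric.ball 0 1) ≤ p / α :=
    ENNReal.toReal_le_of_le_ofReal (by positivity) hdef
  have hV := integral_effectivePotential_le hα hp0 hp1 hM₁ hball
  have hsplit : ∀ (ρ : Measure ℂ) (M : ℝ), IsProbabilityMeasure ρ → (∀ᵐ z ∂ρ, ‖z‖ ≤ M) →
      ∫ z, (‖z‖ ^ 2 - 2 * (α * limitPotential α p z)) ∂ρ
        = α * (∫ z, ‖z‖ ^ 2 / α ∂ρ - 2 * mutualEnergy ρ (normLimitMeasure α p)) :=
    fun ρ M _ hM => by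
      obtain ⟨hU, e⟩ := mutualEnergy_normLimitMeasure (α := α) (p := p) hM
      rw [e, ← integral_const_mul, ← integral_sub (integrable_norm_sq_div hM α) (hU.const_mul 2),
        ← integral_const_mul]
      refine integral_congr_ae (.of_forall fun z => ?_)
      simp only
      field_simp
  rw [hsplit _ _ inferInstance hM₁, hsplit _ _ inferInstance hM₂] at hV
  have hV := le_of_mul_le_mul_left hV hα0
  have hE := energy_sub_ge hφ hφc (M := max M₁ √α) (hM₁.mono fun z hz => hz.trans (le_max_left _ _))
    (hM₂.mono fun z hz => hz.trans (le_max_right _ _)) hb hne hlog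
  have hsq : lam ^ 2 ≤ (∫ z, φ z ∂(ν : Measure ℂ) - ∫ z, φ z ∂(normLimitMeasure α p)) ^ 2 := by
    rw [← sq_abs (_ - _)]
    exact pow_le_pow_left₀ hlam.le hfar 2
  have hD := mul_le_mul_of_nonneg_left hsq
    (div_nonneg Real.two_pi_pos.le (dirichletEnergy_nonneg φ))
  -- The mutual energies in `hV` and `hE` combine: the terms in Σ(ν,μ) cancel, leaving the
  -- difference of the two functionals.
  linarith
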